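/- Let $N\ge 1$ and let $\{a_\alpha\}_{\alpha\in\mathbb Z^N}\subset l^\infty(\mathbb Z^N)$ be complex-valued functions with $\sum_{\alpha}\|a_\alpha\|_\infty<\infty$, each of which is slowly oscillating at infinity, that is, $\lim_{x\to\infty}(a_\alpha(x+y)-a_\alpha(x))=0$ for every $y\in\mathbb Z^N$. For $1<p<\infty$ let $A=\sum_{\alpha\in\mathbb Z^N}a_\alpha V_\alpha$, where $(V_\alpha u)(x)=u(x-\alpha)$, considered as a bounded operator on $l^p(\mathbb Z^N)$. The essential spectrum $\mathrm{sp}_{ess}(A\,|\,l^p)$ is the set of all $\lambda\in\mathbb C$ for which $A-\lambda I$ is not Fredholm on $l^p(\mathbb Z^N)$. The operator spectrum $\mathrm{op}(A\,|\,l^p)$ is the set of all limit operators of $A$, that is, of all bounded operators $A_g$ on $l^p(\mathbb Z^N)$ for which there is a sequence $g:\mathbb N\to\mathbb Z^N$ tending to infinity with $V_{-g(j)}AV_{g(j)}\to A_g$ and $V_{-g(j)}A^*V_{g(j)}\to A_g^*$ strongly (the adjoints act on the dual space of $l^p(\mathbb Z^N)$). **Theorem.** Let $p,q\in(1,\infty)$.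 Every limit operator $A_g\in\mathrm{op}(A\,|\,l^q)$ has constant diagonals: there is exactly one family $(a_\alpha^g)_{\alpha\in\mathbb Z^N}$ of complex numbers with $\sum_\alpha|a^g_\alpha|<\infty$ and $A_g=\sum_\alpha a_\alpha^gV_\alpha$; moreover $a_\alpha^g=\lim_{j\to\infty}a_\alpha(x+g(j))$ for all $\alpha,x\in\mathbb Z^N$ if $A_g$ is defined by the sequence $g$. With the symbol $$\hat A^g(t)=\sum_{\alpha\in\mathbb Z^N}a_\alpha^g\,t^{-\alpha},\qquad t\in\mathbb T^N,\quad t^{-\alpha}=t_1^{-\alpha_1}\cdots t_N^{-\alpha_N},$$ where $\mathbb T$ is the unit circle in $\mathbb C$, one has $$\mathrm{sp}_{ess}(A\,|\,l^p)=\bigcup_{A_g\in \mathrm{op}(A\,|\,l^q)}\mathrm{sp}(A_g\,|\,l^q)=\bigcup_{A_g\in \mathrm{op}(A\,|\,l^q)}\ \bigcup_{t\in\mathbb T^N}\{\hat A^g(t)\}.$$ In particular, $\mathrm{sp}_{ess}(A\,|\,l^p)$ does not depend on $p\in(1,\infty)$. -/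

import Mathlib

open Filter Topology Set
open scoped ENNReal

noncomputable section

/-- The lattice `ℤ^N`. -/
abbrev IntLattice (N : ℕ) : Type := Fin N → ℤ

/-- The Banach space `l^p(ℤ^N)` of complex-valued functions on `ℤ^N`. -/
abbrev LatticeLp (N : ℕ) (p : ℝ≥0∞) : Type := lp (fun _ : IntLattice N => ℂ) p

namespace LatticeOp

variable {N : ℕ} {p : ℝ≥0∞}

theorem memLp_shift (g : IntLattice N) {u : IntLattice N → ℂ} (hu : Memℓp u p) :
    Memℓp (fun x => u (x - g)) p := by
  obtain (rfl | rfl | hp) := p.trichotomy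
  · rw [memℓp_zero_iff] at hu ⊢
    exact hu.preimage (sub_left_injective.injOn)
  · rw [memℓp_infty_iff] at hu ⊢
    refine hu.mono ?_
    rintro _ ⟨x, rfl⟩
    exact ⟨x - g, rfl⟩
  · rw [memℓp_gen_iff hp] at hu ⊢
    exact (Equiv.subRight g).summable_iff.mpr hu

/-- The translate of a function in `l^p(ℤ^N)`. -/
def shiftFun (g : IntLattice N) (u : LatticeLp N p) : LatticeLp N p :=
  ⟨fun x => u (x - g), memLp_shift g (lp.memℓp u)⟩

theorem norm_shiftFun_le [Fact (1 ≤ p)] (g : IntLattice N) (u : LatticeLp N p) :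
    ‖shiftFun g u‖ ≤ 1 * ‖u‖ := by
  rw [one_mul]
  obtain (rfl | hp) := p.dichotomy
  · exact lp.norm_le_of_forall_le (norm_nonneg _) fun x =>
      lp.norm_apply_le_norm (by simp) u (x - g)
  · have hp0 : 0 < p.toReal := by linarith
    refine lp.norm_le_of_tsum_le hp0 (norm_nonneg _) (le_of_eq ?_)
    rw [lp.norm_rpow_eq_tsum hp0]
    exact (Equiv.subRight g).tsum_eq (fun x => ‖u x‖ ^ p.toReal)

/-- The shift operator `V_g` on `l^p(ℤ^N)`, `(V_g u)(x) = u(x - g)`. -/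
def shift [Fact (1 ≤ p)] (g : IntLattice N) : LatticeLp N p →L[ℂ] LatticeLp N p :=
  LinearMap.mkContinuous
    { toFun := shiftFun g
      map_add' := fun _ _ => rfl
      map_smul' := fun _ _ => rfl } 1 (norm_shiftFun_le g)

@[simp] theorem shift_apply [Fact (1 ≤ p)] (g : IntLattice N) (u : LatticeLp N p) (x : IntLattice N) :
    shift g u x = u (x - g) := rfl

theorem norm_mul_apply_le (a : LatticeLp N ∞) (u : LatticeLp N p) (x : IntLattice N) :
    ‖a x * u x‖ ≤ ‖(‖a‖ • u) x‖ := by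
  rw [lp.coeFn_smul, Pi.smul_apply, norm_smul, norm_mul, norm_norm]
  exact mul_le_mul_of_nonneg_right (lp.norm_apply_le_norm (by simp) a x) (norm_nonneg _)

/-- The pointwise product of a bounded function with a function in `l^p(ℤ^N)`. -/
def mulFun (a : LatticeLp N ∞) (u : LatticeLp N p) : LatticeLp N p :=
  ⟨fun x => a x * u x, (lp.memℓp (‖a‖ • u)).mono' (norm_mul_apply_le a u)⟩

theorem norm_mulFun_le [Fact (1 ≤ p)] (a : LatticeLp N ∞) (u : LatticeLp N p) :
    ‖mulFun a u‖ ≤ ‖a‖ * ‖u‖ := by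
  have hp : p ≠ 0 := (zero_lt_one.trans_le (Fact.out : 1 ≤ p)).ne'
  have h := lp.norm_mono hp (x := mulFun a u) (y := ‖a‖ • u) (norm_mul_apply_le a u)
  rwa [norm_smul, norm_norm] at h

/-- The operator `a I` of multiplication by the bounded function `a`. -/
def mulOp [Fact (1 ≤ p)] (a : LatticeLp N ∞) : LatticeLp N p →L[ℂ] LatticeLp N p :=
  LinearMap.mkContinuous
    { toFun := mulFun a
      map_add' := fun u v => lp.ext (funext fun x => mul_add (a x) (u x) (v x))
      map_smul' := fun c u => lp.ext (funext fun x => mul_left_comm (a x) c (u x)) }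
    ‖a‖ (norm_mulFun_le a)

@[simp] theorem mulOp_apply [Fact (1 ≤ p)] (a : LatticeLp N ∞) (u : LatticeLp N p)
    (x : IntLattice N) : mulOp a u x = a x * u x := rfl

variable (p) in
/-- The operator `A = ∑_α a_α V_α` on `l^p(ℤ^N)`. It belongs to the Wiener algebra when
`∑_α ‖a_α‖_∞ < ∞`; the series then converges in operator norm, see `hasSum_wienerOp`. -/
def wienerOp [Fact (1 ≤ p)] (a : IntLattice N → LatticeLp N ∞) :
    LatticeLp N p →L[ℂ] LatticeLp N p :=
  ∑' α, mulOp (a α) ∘L shift α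

theorem norm_mulOp_comp_shift_le [Fact (1 ≤ p)] (a : LatticeLp N ∞) (g : IntLattice N) :
    ‖(mulOp a ∘L shift g : LatticeLp N p →L[ℂ] LatticeLp N p)‖ ≤ ‖a‖ := by
  refine ContinuousLinearMap.opNorm_le_bound _ (norm_nonneg _) fun u => ?_
  refine (norm_mulFun_le a (shiftFun g u)).trans ?_
  have h := norm_shiftFun_le g u
  rw [one_mul] at h
  exact mul_le_mul_of_nonneg_left h (norm_nonneg _)

theorem hasSum_wienerOp [Fact (1 ≤ p)] {a : IntLattice N → LatticeLp N ∞}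
    (ha : Summable fun α => ‖a α‖) :
    HasSum (fun α => (mulOp (a α) ∘L shift α : LatticeLp N p →L[ℂ] LatticeLp N p))
      (wienerOp p a) :=
  (Summable.of_norm_bounded ha fun α => norm_mulOp_comp_shift_le (a α) α).hasSum

/-- The operator acts by `(A u)(x) = ∑_α a_α(x) u(x - α)`. -/
theorem hasSum_wienerOp_apply [Fact (1 ≤ p)] {a : IntLattice N → LatticeLp N ∞}
    (ha : Summable fun α => ‖a α‖) (u : LatticeLp N p) (x : IntLattice N) :
    HasSum (fun α => a α x * u (x - α)) (wienerOp p a u x) :=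
  ((hasSum_wienerOp ha).mapL (ContinuousLinearMap.apply ℂ (LatticeLp N p) u)).mapL
    (lp.evalCLM ℂ (fun _ : IntLattice N => ℂ) (p := p) x)

/-- A function `a` on `ℤ^N` is slowly oscillating at infinity if `a(x + y) - a(x) → 0` as
`x → ∞`, for every `y`. (In the discrete space `ℤ^N`, neighbourhoods of infinity are
complements of finite sets.) -/
def SlowlyOscillating (a : IntLattice N → ℂ) : Prop :=
  ∀ y : IntLattice N, Tendsto (fun x => a (x + y) - a x) cofinite (𝓝 0)

/-- The Banach space adjoint `A^*`, acting on the dual of `l^p(ℤ^N)` by `φ ↦ φ ∘ A`. -/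
def adj [Fact (1 ≤ p)] (A : LatticeLp N p →L[ℂ] LatticeLp N p) :
    StrongDual ℂ (LatticeLp N p) →L[ℂ] StrongDual ℂ (LatticeLp N p) :=
  ContinuousLinearMap.precomp ℂ A

/-- The translated operator `V_{-g} A V_g`. -/
def conjShift [Fact (1 ≤ p)] (A : LatticeLp N p →L[ℂ] LatticeLp N p) (g : IntLattice N) :
    LatticeLp N p →L[ℂ] LatticeLp N p :=
  shift (-g) ∘L A ∘L shift g

/-- `B` is the limit operator of `A` defined by the sequence `h` tending to infinity:
`V_{-h(j)} A V_{h(j)} → B` and `(V_{-h(j)} A V_{h(j)})^* → B^*` strongly. When the dual of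
`l^p` is identified with `l^q`, the adjoint of `V_g` is `V_{-g}`, and so
`(V_{-h(j)} A V_{h(j)})^*` is `V_{-h(j)} A^* V_{h(j)}`. -/
structure IsLimitOperator [Fact (1 ≤ p)] (A : LatticeLp N p →L[ℂ] LatticeLp N p)
    (h : ℕ → IntLattice N) (B : LatticeLp N p →L[ℂ] LatticeLp N p) : Prop where
  tendsto_infinity : Tendsto h atTop cofinite
  tendsto_apply : ∀ u, Tendsto (fun j => conjShift A (h j) u) atTop (𝓝 (B u))
  tendsto_adj : ∀ φ, Tendsto (fun j => adj (conjShift A (h j)) φ) atTop (𝓝 (adj B φ))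

/-- The operator spectrum `op(A)`: the set of all limit operators of `A`. -/
def operatorSpectrum [Fact (1 ≤ p)] (A : LatticeLp N p →L[ℂ] LatticeLp N p) :
    Set (LatticeLp N p →L[ℂ] LatticeLp N p) :=
  {B | ∃ h, IsLimitOperator A h B}

/-- On a Banach space, the operator `A` is Fredholm if and only if its kernel and its cokernel are
finite dimensional. -/
theorem isFredholm_iff {E : Type*} [NormedAddCommGroup E] [NormedSpace ℂ E] [CompleteSpace E]
    (A : E →L[ℂ] E) :
    A.IsFredholm ↔ FiniteDimensional ℂ A.ker ∧ FiniteDimensional ℂ (E ⧸ A.range) := by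
  refine ⟨fun h => ⟨h.finite_ker, h.finite_coker⟩, ?_⟩
  rintro ⟨hk, hc⟩
  have hcompl : A.ker.ClosedComplemented := .of_finiteDimensional _
  obtain ⟨K, hKc, hK⟩ := hcompl.exists_isClosed_isCompl
  obtain ⟨G, hG⟩ := A.range.exists_isCompl
  have : FiniteDimensional ℂ G :=
    LinearEquiv.finiteDimensional (Submodule.quotientEquivOfIsCompl _ _ hG)
  have : CompleteSpace K := hKc.completeSpace_coe
  have hr : (A ∘L K.subtypeL).range = A.range := by
    apply le_antisymm
    · rintro _ ⟨x, rfl⟩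
      exact ⟨x, rfl⟩
    · rintro _ ⟨x, rfl⟩
      obtain ⟨y, hy, z, hz, rfl⟩ :=
        Submodule.mem_sup.mp (hK.sup_eq_top.ge (Submodule.mem_top (x := x)))
      refine ⟨⟨z, hz⟩, ?_⟩
      have hy' : A y = 0 := hy
      simp [hy']
  have hker : (A ∘L K.subtypeL).ker = ⊥ := by
    rw [eq_bot_iff]
    rintro ⟨x, hx⟩ hx'
    have h1 : x ∈ A.ker := hx'
    exact (Submodule.mem_bot ℂ).mpr (Subtype.ext (Submodule.disjoint_def.mp hK.disjoint x h1 hx))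
  have hcl : IsClosed (A.range : Set E) := by
    rw [← hr]
    exact ContinuousLinearMap.closed_complemented_range_of_isCompl_of_ker_eq_bot _ G
      (hr ▸ hG) G.closed_of_finiteDimensional hker
  have : CompleteSpace A.range := hcl.completeSpace_coe
  have hs : IsStrictMap A :=
    ContinuousLinearMap.isQuotientMap (A.codRestrict A.range fun x => ⟨x, rfl⟩) (by
      rintro ⟨_, x, rfl⟩
      exact ⟨x, rfl⟩)
  exact ⟨hs, hcl, hk, hc, hcompl⟩

/-- The essential spectrum: all `μ` for which `A - μ I` is not Fredholm, see `isFredholm_iff`. -/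
def essentialSpectrum [Fact (1 ≤ p)] (A : LatticeLp N p →L[ℂ] LatticeLp N p) : Set ℂ :=
  {μ | ¬ (A - μ • ContinuousLinearMap.id ℂ (LatticeLp N p)).IsFredholm}

/-- `B = ∑_α c_α V_α` with constants `c_α` such that `∑_α |c_α| < ∞`. -/
def HasConstantDiagonals [Fact (1 ≤ p)] (B : LatticeLp N p →L[ℂ] LatticeLp N p)
    (c : IntLattice N → ℂ) : Prop :=
  (Summable fun α => ‖c α‖) ∧ B = ∑' α, c α • shift α

/-- The symbol `t ↦ ∑_α c_α t^{-α}`, `t ∈ 𝕋^N`, of the operator `∑_α c_α V_α`. -/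
def symbol (c : IntLattice N → ℂ) (t : Fin N → Circle) : ℂ :=
  ∑' α, c α * ∏ i, (t i : ℂ) ^ (-α i)

end LatticeOp

end

noncomputable section

section TwoSidedQuotient

variable {R : Type*} [NormedRing R] (I : Ideal R) [I.IsTwoSided] [IsClosed (I : Set R)]

/-- The quotient of a normed ring by a closed two-sided ideal is a normed ring. -/
abbrev Ideal.Quotient.normedRingOfIsTwoSided : NormedRing (R ⧸ I) where
  __ := Submodule.Quotient.normedAddCommGroup I
  __ := Ideal.Quotient.ring I
  dist_eq := (Submodule.Quotient.normedAddCommGroup I).dist_eq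
  norm_mul_le x y := le_of_forall_pos_le_add fun ε hε => by
    have h : Tendsto (fun δ : ℝ => (‖x‖ + δ) * (‖y‖ + δ)) (𝓝[>] 0) (𝓝 (‖x‖ * ‖y‖)) := by
      have h' : Continuous fun δ : ℝ => (‖x‖ + δ) * (‖y‖ + δ) := by fun_prop
      simpa using (h'.tendsto 0).mono_left nhdsWithin_le_nhds
    obtain ⟨δ, hδ, hδ0⟩ :=
      ((h.eventually (eventually_lt_nhds (lt_add_of_pos_right _ hε))).and
        self_mem_nhdsWithin).exists
    obtain ⟨a, rfl, ha⟩ := Submodule.Quotient.norm_mk_lt (S := I) x hδ0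
    obtain ⟨b, rfl, hb⟩ := Submodule.Quotient.norm_mk_lt (S := I) y hδ0
    calc _ ≤ ‖a * b‖ := Submodule.Quotient.norm_mk_le I (a * b)
      _ ≤ ‖a‖ * ‖b‖ := norm_mul_le a b
      _ ≤ _ := mul_le_mul ha.le hb.le (norm_nonneg _) ((norm_nonneg _).trans ha.le)
      _ ≤ _ := hδ.le

/-- The quotient of a normed algebra by a closed two-sided ideal is a normed algebra. -/
abbrev Ideal.Quotient.normedAlgebraOfIsTwoSided [NormedAlgebra ℂ R] :
    letI := Ideal.Quotient.normedRingOfIsTwoSided I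
    NormedAlgebra ℂ (R ⧸ I) :=
  letI := Ideal.Quotient.normedRingOfIsTwoSided I
  { Ideal.Quotient.algebra ℂ, Submodule.Quotient.normedSpace I ℂ with }

end TwoSidedQuotient

section Gelfand

variable {A : Type*} [NormedRing A] [NormedAlgebra ℂ A] [CompleteSpace A]

/-- An element of the closed subalgebra generated by a commuting set is invertible if no character
of this subalgebra vanishes on it. -/
theorem isUnit_of_forall_algHom_ne_zero {s : Set A} (hs : ∀ x ∈ s, ∀ y ∈ s, x * y = y * x)
    (a : (Algebra.adjoin ℂ s).topologicalClosure)
    (h : ∀ χ : (Algebra.adjoin ℂ s).topologicalClosure →ₐ[ℂ] ℂ, Continuous χ → χ a ≠ 0) :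
    IsUnit (a : A) := by
  let C := (Algebra.adjoin ℂ s).topologicalClosure
  have hcomm := (Algebra.isMulCommutative_adjoin ℂ hs).is_comm.comm
  let : NormedCommRing C :=
    { (inferInstance : NormedRing C),
      (Algebra.adjoin ℂ s).commRingTopologicalClosure hcomm with }
  have : CompleteSpace C :=
    (Subalgebra.isClosed_topologicalClosure (Algebra.adjoin ℂ s)).completeSpace_coe
  suffices hu : IsUnit (a : C) from hu.map C.val
  by_contra hu
  obtain ⟨f, hf⟩ := WeakDual.CharacterSpace.exists_apply_eq_zero (A := C) hu
  exact h (WeakDual.CharacterSpace.equivAlgHom f) (map_continuous f) hf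

/-- A character of `ℤ^N` that is bounded by one takes the form `α ↦ t^{-α}` with `t` in the
torus. -/
theorem exists_circle_eq_prod_zpow {N : ℕ} (f : Multiplicative (Fin N → ℤ) →* ℂ)
    (hf : ∀ α, ‖f α‖ ≤ 1) :
    ∃ t : Fin N → Circle, ∀ α : Fin N → ℤ, f (.ofAdd α) = ∏ i, (t i : ℂ) ^ (-α i) := by
  have hmul (α : Fin N → ℤ) : f (.ofAdd α) * f (.ofAdd (-α)) = 1 := by
    rw [← map_mul, ← ofAdd_add, add_neg_cancel, ofAdd_zero, map_one]
  have hnorm (α : Fin N → ℤ) : ‖f (.ofAdd α)‖ = 1 := by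
    refine le_antisymm (hf _) ?_
    have h := congrArg norm (hmul α)
    rw [norm_mul, norm_one] at h
    nlinarith [hf (.ofAdd (-α)), hf (.ofAdd α), norm_nonneg (f (.ofAdd α)),
      norm_nonneg (f (.ofAdd (-α)))]
  refine ⟨fun i => ⟨f (.ofAdd (-Pi.single i 1)), mem_sphere_zero_iff_norm.2 (hnorm _)⟩,
    fun α => ?_⟩
  have hα : α = ∑ i, (-α i) • (-Pi.single i (1 : ℤ) : Fin N → ℤ) := by
    ext j
    simp [Finset.sum_apply, Pi.single_apply]
  have hz (β : Fin N → ℤ) (n : ℤ) : f (.ofAdd (n • β)) = f (.ofAdd β) ^ n := by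
    let F : Multiplicative (Fin N → ℤ) →* ℂˣ := f.toHomUnits
    have hF (γ) : (F γ : ℂ) = f γ := rfl
    rw [← hF, ← hF, ofAdd_zsmul, map_zpow, Units.val_zpow_eq_zpow_val]
  conv_lhs => rw [hα]
  rw [ofAdd_sum, map_prod]
  simp only [hz]

/-- Wiener's lemma: if `T = ∑_α m_α v_α`, where the `v_α` are contractive and represent `ℤ^N`, and
the `m_α` belong to a commuting set commuting with all `v_α`, then `T` is invertible as soon as
`∑_α t^{-α} m_α` is invertible for every `t` in the torus. -/
theorem isUnit_of_forall_torus {N : ℕ} (v : Multiplicative (Fin N → ℤ) →* A)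
    (hv : ∀ g, ‖v g‖ ≤ 1) {S : Set A} (hS : ∀ x ∈ S, ∀ y ∈ S, x * y = y * x)
    (hSv : ∀ x ∈ S, ∀ g, x * v g = v g * x) {m : (Fin N → ℤ) → A} (hm : ∀ α, m α ∈ S) {T : A}
    (hT : HasSum (fun α => m α * v (.ofAdd α)) T)
    (h : ∀ t : Fin N → Circle, ∃ b ∈ S, ∃ c ∈ S,
      HasSum (fun α : Fin N → ℤ => (∏ i, (t i : ℂ) ^ (-α i)) • m α) b ∧ b * c = 1) :
    IsUnit T := by
  let s : Set A := S ∪ range v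
  have hs : ∀ x ∈ s, ∀ y ∈ s, x * y = y * x := by
    rintro x (hx | ⟨g, rfl⟩) y (hy | ⟨g', rfl⟩)
    · exact hS x hx y hy
    · exact hSv x hx g'
    · exact (hSv y hy g).symm
    · rw [← map_mul, mul_comm, map_mul]
  let C := (Algebra.adjoin ℂ s).topologicalClosure
  have hsC {x} (hx : x ∈ s) : x ∈ C :=
    Subalgebra.le_topologicalClosure _ (Algebra.subset_adjoin hx)
  have hmem {ι : Type _} {f : ι → A} {a : A} (hf : ∀ i, f i ∈ C) (hfa : HasSum f a) : a ∈ C :=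
    (Subalgebra.isClosed_topologicalClosure (Algebra.adjoin ℂ s)).mem_of_tendsto hfa
      (Eventually.of_forall fun F => C.sum_mem fun i _ => hf i)
  let m' (α : Fin N → ℤ) : C := ⟨m α, hsC (.inl (hm α))⟩
  let v' : Multiplicative (Fin N → ℤ) →* C :=
    v.codRestrict C.toSubmonoid fun g => hsC (.inr ⟨g, rfl⟩)
  let T' : C := ⟨T, hmem (fun α => (m' α * v' (.ofAdd α)).2) hT⟩
  have hT' : HasSum (fun α => m' α * v' (.ofAdd α)) T' :=
    (Topology.IsInducing.hasSum_iff (g := C.val) .subtypeVal _ _).1 hT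
  refine isUnit_of_forall_algHom_ne_zero hs T' fun χ hχ hχT => ?_
  have : CompleteSpace C :=
    (Subalgebra.isClosed_topologicalClosure (Algebra.adjoin ℂ s)).completeSpace_coe
  have hbd (α : Multiplicative (Fin N → ℤ)) : ‖χ (v' α)‖ ≤ 1 := by
    have h1 : ‖(1 : C)‖ ≤ 1 := by
      have := hv 1
      rwa [map_one] at this
    calc ‖χ (v' α)‖ ≤ ‖v' α‖ * ‖(1 : C)‖ := AlgHom.norm_apply_le_self_mul_norm_one χ _
      _ ≤ 1 * 1 := mul_le_mul (hv α) h1 (norm_nonneg _) zero_le_one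
      _ = 1 := one_mul 1
  obtain ⟨t, ht⟩ := exists_circle_eq_prod_zpow ((χ : C →* ℂ).comp v') hbd
  obtain ⟨b, hb, c, hc, hsum, hbc⟩ := h t
  let b' : C := ⟨b, hsC (.inl hb)⟩
  let c' : C := ⟨c, hsC (.inl hc)⟩
  have hsum' : HasSum (fun α : Fin N → ℤ => (∏ i, (t i : ℂ) ^ (-α i)) • m' α) b' :=
    (Topology.IsInducing.hasSum_iff (g := C.val) .subtypeVal _ _).1 hsum
  have h1 : HasSum (fun α : Fin N → ℤ => (∏ i, (t i : ℂ) ^ (-α i)) * χ (m' α)) (χ b') := by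
    have := hsum'.map χ hχ
    simpa [Function.comp_def] using this
  have h2 : HasSum (fun α : Fin N → ℤ => (∏ i, (t i : ℂ) ^ (-α i)) * χ (m' α)) (χ T') := by
    have := hT'.map χ hχ
    convert this using 2 with α
    rw [Function.comp_apply, map_mul, mul_comm, ← ht]
    rfl
  have hbc' : b' * c' = 1 := Subtype.ext hbc
  have := congrArg χ hbc'
  rw [map_mul, map_one, h1.unique h2, hχT, zero_mul] at this
  exact zero_ne_one this

end Gelfand

section FiniteRank

variable (E : Type*) [NormedAddCommGroup E] [NormedSpace ℂ E]

/-- The ideal of bounded operators of finite rank. -/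
def finiteRankIdeal : Ideal (E →L[ℂ] E) where
  carrier := {T | T.toLinearMap.HasFiniteRange}
  add_mem' hS hT := LinearMap.HasFiniteRange.add hS hT
  zero_mem' := LinearMap.HasFiniteRange.zero
  smul_mem' S _ hT := LinearMap.HasFiniteRange.comp_left hT S.toLinearMap

instance : (finiteRankIdeal E).IsTwoSided :=
  ⟨fun T hS => LinearMap.HasFiniteRange.comp_right hS T.toLinearMap⟩

/-- The closed ideal of operators which can be approximated by operators of finite rank. -/
def approximableIdeal : Ideal (E →L[ℂ] E) :=
  (finiteRankIdeal E).closure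

instance : (approximableIdeal E).IsTwoSided :=
  ⟨fun {S} T (hS : S ∈ closure (finiteRankIdeal E : Set (E →L[ℂ] E))) =>
    show S * T ∈ closure (finiteRankIdeal E : Set (E →L[ℂ] E)) from
      map_mem_closure (f := fun S => S * T) (continuous_mul_const T) hS
        fun _ h => Ideal.mul_mem_right T (finiteRankIdeal E) h⟩

instance : IsClosed (approximableIdeal E : Set (E →L[ℂ] E)) :=
  isClosed_closure

/-- The algebra of bounded operators modulo approximable operators. -/
abbrev ApproximableQuotient : Type _ := (E →L[ℂ] E) ⧸ approximableIdeal E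

instance : NormedRing (ApproximableQuotient E) :=
  Ideal.Quotient.normedRingOfIsTwoSided _

instance : NormedAlgebra ℂ (ApproximableQuotient E) :=
  Ideal.Quotient.normedAlgebraOfIsTwoSided _

variable {E}

theorem exists_isUnit_sub_mem_finiteRankIdeal [CompleteSpace E] {T : E →L[ℂ] E}
    (hT : T - 1 ∈ approximableIdeal E) : ∃ S : E →L[ℂ] E, IsUnit S ∧ T - S ∈ finiteRankIdeal E := by
  obtain ⟨F, hF, hd⟩ := Metric.mem_closure_iff.1 hT 1 one_pos
  refine ⟨T - F, ?_, by simpa using hF⟩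
  have := isUnit_one_sub_of_norm_lt_one (x := -(T - 1 - F)) (by rwa [norm_neg, ← dist_eq_norm])
  convert this using 1
  abel

/-- Operators invertible modulo approximable operators are Fredholm. -/
theorem isFredholm_of_isUnit_mk [CompleteSpace E] {T : E →L[ℂ] E}
    (hT : IsUnit (Ideal.Quotient.mk (approximableIdeal E) T)) : T.IsFredholm := by
  obtain ⟨r, hr1, hr2⟩ := isUnit_iff_exists.1 hT
  obtain ⟨R, rfl⟩ := Ideal.Quotient.mk_surjective r
  rw [← map_mul, ← map_one (Ideal.Quotient.mk _), Ideal.Quotient.eq] at hr1 hr2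
  obtain ⟨S, ⟨S, rfl⟩, hF⟩ := exists_isUnit_sub_mem_finiteRankIdeal hr2
  obtain ⟨S', ⟨S', rfl⟩, hF'⟩ := exists_isUnit_sub_mem_finiteRankIdeal hr1
  refine (LatticeOp.isFredholm_iff T).2 ⟨?_, ?_⟩
  · have h : (((S⁻¹ : (E →L[ℂ] E)ˣ) : E →L[ℂ] E) * (R * T - S)).toLinearMap.HasFiniteRange :=
      (finiteRankIdeal E).mul_mem_left _ hF
    rw [mul_sub, Units.inv_mul] at h
    have : FiniteDimensional ℂ (LinearMap.range
      (((S⁻¹ : (E →L[ℂ] E)ˣ) : E →L[ℂ] E) * (R * T) - 1).toLinearMap) :=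
      Module.Finite.iff_fg.2 h
    refine Submodule.finiteDimensional_of_le (S₂ := LinearMap.range
      (((S⁻¹ : (E →L[ℂ] E)ˣ) : E →L[ℂ] E) * (R * T) - 1).toLinearMap) ?_
    intro x hx
    have hx' : T x = 0 := hx
    exact ⟨-x, by simp [hx']⟩
  · have h : ((T * R - S') * ((S'⁻¹ : (E →L[ℂ] E)ˣ) : E →L[ℂ] E)).toLinearMap.HasFiniteRange :=
      Ideal.mul_mem_right _ (finiteRankIdeal E) hF'
    rw [sub_mul, Units.mul_inv] at h
    set F := (T * R * ((S'⁻¹ : (E →L[ℂ] E)ˣ) : E →L[ℂ] E) - 1).toLinearMap with hFdef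
    have : FiniteDimensional ℂ (LinearMap.range F) := Module.Finite.iff_fg.2 h
    refine Module.Finite.of_surjective (T.range.mkQ ∘ₗ (LinearMap.range F).subtype) ?_
    intro y
    obtain ⟨x, rfl⟩ := Submodule.mkQ_surjective _ y
    refine ⟨⟨F (-x), -x, rfl⟩, ?_⟩
    rw [LinearMap.comp_apply, ← sub_eq_zero, ← map_sub, Submodule.mkQ_apply,
      Submodule.Quotient.mk_eq_zero]
    refine ⟨-(R (((S'⁻¹ : (E →L[ℂ] E)ˣ) : E →L[ℂ] E) x)), ?_⟩
    simp [hFdef]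

end FiniteRank

namespace LatticeOp

variable {N : ℕ} {p : ℝ≥0∞} [Fact (1 ≤ p)]

@[simp] theorem shift_zero :
    shift (0 : IntLattice N) = (1 : LatticeLp N p →L[ℂ] LatticeLp N p) := by
  ext u x
  simp

theorem shift_add (g h : IntLattice N) :
    (shift (g + h) : LatticeLp N p →L[ℂ] LatticeLp N p) = shift g * shift h := by
  ext u x
  simp [sub_sub]

theorem norm_shift_le (g : IntLattice N) :
    ‖(shift g : LatticeLp N p →L[ℂ] LatticeLp N p)‖ ≤ 1 :=
  LinearMap.mkContinuous_norm_le _ zero_le_one _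

@[simp] theorem norm_shift_apply (g : IntLattice N) (u : LatticeLp N p) :
    ‖shift g u‖ = ‖u‖ := by
  have h (g : IntLattice N) (u : LatticeLp N p) : ‖shift g u‖ ≤ ‖u‖ :=
    (norm_shiftFun_le g u).trans_eq (one_mul _)
  refine (h g u).antisymm ?_
  have h' := h (-g) (shift g u)
  rwa [← mul_apply_eq_comp, ← shift_add, neg_add_cancel, shift_zero,
    one_apply_eq_self] at h'

variable (N p) in
/-- The representation `g ↦ V_g` of `ℤ^N` by shifts. -/
def shiftHom : Multiplicative (IntLattice N) →* (LatticeLp N p →L[ℂ] LatticeLp N p) where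
  toFun g := shift g.toAdd
  map_one' := shift_zero
  map_mul' g h := shift_add g.toAdd h.toAdd

@[simp] theorem shiftHom_ofAdd (g : IntLattice N) : shiftHom N p (.ofAdd g) = shift g := rfl

variable (N p) in
/-- The representation of bounded functions by multiplication operators. -/
def mulHom : LatticeLp N ∞ →ₐ[ℂ] (LatticeLp N p →L[ℂ] LatticeLp N p) where
  toFun := mulOp
  map_one' := by ext u x; simp
  map_mul' a b := by ext u x; simp [mul_assoc]
  map_zero' := by ext u x; simp
  map_add' a b := by ext u x; simp [add_mul]
  commutes' c := by
    ext u x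
    rw [mulOp_apply, Algebra.algebraMap_eq_smul_one, Algebra.algebraMap_eq_smul_one]
    simp

@[simp] theorem mulHom_apply (a : LatticeLp N ∞) : mulHom N p a = mulOp a := rfl

theorem norm_mulOp_le (a : LatticeLp N ∞) :
    ‖(mulOp a : LatticeLp N p →L[ℂ] LatticeLp N p)‖ ≤ ‖a‖ :=
  LinearMap.mkContinuous_norm_le _ (norm_nonneg _) _

variable (N p) in
theorem continuous_mulHom : Continuous (mulHom N p) :=
  AddMonoidHomClass.continuous_of_bound _ 1 fun a => by
    rw [one_mul]
    exact norm_mulOp_le a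

theorem shift_mul_mulOp (g : IntLattice N) (a : LatticeLp N ∞) :
    (shift g * mulOp a : LatticeLp N p →L[ℂ] LatticeLp N p) = mulOp (shift g a) * shift g := by
  ext u x
  simp

/-- A bounded function as an element of `l^∞`. -/
def ofBounded (f : IntLattice N → ℂ) (C : ℝ) (h : ∀ x, ‖f x‖ ≤ C) : LatticeLp N ∞ :=
  ⟨f, memℓp_infty ⟨C, by rintro _ ⟨x, rfl⟩; exact h x⟩⟩

@[simp] theorem ofBounded_apply (f : IntLattice N → ℂ) (C : ℝ) (h : ∀ x, ‖f x‖ ≤ C)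
    (x : IntLattice N) : ofBounded f C h x = f x := rfl

open scoped Classical in
/-- The indicator function of a set as an element of `l^∞`. -/
def indicatorLp (s : Set (IntLattice N)) : LatticeLp N ∞ :=
  ofBounded (fun x => if x ∈ s then 1 else 0) 1 fun x => by split_ifs <;> simp

open scoped Classical in
@[simp] theorem indicatorLp_apply (s : Set (IntLattice N)) (x : IntLattice N) :
    indicatorLp s x = if x ∈ s then 1 else 0 := rfl

theorem mulOp_indicatorLp_add_compl (s : Set (IntLattice N)) (u : LatticeLp N p) :
    mulOp (indicatorLp s) u + mulOp (indicatorLp sᶜ) u = u := by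
  ext x
  by_cases h : x ∈ s <;> simp [h]

theorem mulOp_indicatorLp_finset (F : Finset (IntLattice N)) (u : LatticeLp N p) :
    mulOp (indicatorLp (F : Set (IntLattice N))) u = ∑ x ∈ F, lp.single p x (u x) := by
  classical
  ext y
  refine Eq.trans ?_ (map_sum (lp.evalCLM ℂ (fun _ : IntLattice N => ℂ) p y)
    (fun x => lp.single p x (u x)) F).symm
  change _ = ∑ x ∈ F, lp.single p x (u x) y
  simp [Pi.single_apply]

omit [Fact (1 ≤ p)] in
theorem pos_of_one_le [h : Fact (1 ≤ p)] : 0 < p := zero_lt_one.trans_le h.out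

theorem norm_mulOp_indicatorLp_finset_le (F : Finset (IntLattice N)) (u : LatticeLp N p) :
    ‖mulOp (indicatorLp (F : Set (IntLattice N))) u‖ ≤ ∑ x ∈ F, ‖u x‖ := by
  rw [mulOp_indicatorLp_finset]
  refine (norm_sum_le _ _).trans (Finset.sum_le_sum fun x _ => ?_)
  rw [lp.norm_single pos_of_one_le]

theorem tendsto_mulOp_indicatorLp_compl (hp : p ≠ ∞) (u : LatticeLp N p) :
    Tendsto (fun F : Finset (IntLattice N) => mulOp (indicatorLp (F : Set (IntLattice N))ᶜ) u)
      atTop (𝓝 0) := by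
  have h := (lp.hasSum_single hp u).const_sub u
  rw [sub_self] at h
  refine h.congr fun F => ?_
  rw [← mulOp_indicatorLp_finset, sub_eq_iff_eq_add', mulOp_indicatorLp_add_compl]

theorem mulOp_mem_approximableIdeal {a : LatticeLp N ∞} (ha : Tendsto a cofinite (𝓝 0)) :
    (mulOp a : LatticeLp N p →L[ℂ] LatticeLp N p) ∈ approximableIdeal (LatticeLp N p) := by
  refine Metric.mem_closure_iff.2 fun ε hε => ?_
  have hfin : {x | ¬ ‖a x‖ < ε / 2}.Finite := by
    have := ha.norm
    rw [norm_zero] at this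
    exact this.eventually (gt_mem_nhds (half_pos hε))
  let F := hfin.toFinset
  refine ⟨mulOp (indicatorLp (F : Set (IntLattice N))) * mulOp a,
    Ideal.mul_mem_right _ (finiteRankIdeal _) ?_, ?_⟩
  · have : FiniteDimensional ℂ
        (Submodule.span ℂ ((fun x => lp.single p x (1 : ℂ)) '' (F : Set (IntLattice N)))) :=
      FiniteDimensional.span_of_finite ℂ (F.finite_toSet.image _)
    refine Module.Finite.iff_fg.1 (Submodule.finiteDimensional_of_le (S₂ := Submodule.span ℂ
      ((fun x => lp.single p x (1 : ℂ)) '' (F : Set (IntLattice N)))) ?_)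
    rintro _ ⟨u, rfl⟩
    change mulOp _ u ∈ _
    rw [mulOp_indicatorLp_finset]
    refine Submodule.sum_mem _ fun x hx => ?_
    rw [← mul_one (u x), ← smul_eq_mul, lp.single_smul]
    exact Submodule.smul_mem _ _ (Submodule.subset_span ⟨x, hx, rfl⟩)
  · rw [dist_eq_norm, ← mulHom_apply, ← mulHom_apply, ← map_mul, ← map_sub, mulHom_apply]
    refine (norm_mulOp_le _).trans_lt (lt_of_le_of_lt ?_ (half_lt_self hε))
    refine lp.norm_le_of_forall_le (half_pos hε).le fun x => ?_
    change ‖a x - indicatorLp (F : Set (IntLattice N)) x * a x‖ ≤ ε / 2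
    by_cases hx : ‖a x‖ < ε / 2
    · simpa [F, not_le.2 hx] using hx.le
    · simpa [F, not_lt.1 hx] using (half_pos hε).le

theorem tendsto_cofinite_zero (hp : p ≠ ∞) (u : LatticeLp N p) : Tendsto u cofinite (𝓝 0) := by
  have hp0 : 0 < p.toReal := ENNReal.toReal_pos pos_of_one_le.ne' hp
  have h := ((lp.memℓp u).summable hp0).tendsto_cofinite_zero
  have h' := h.rpow_const (p := p.toReal⁻¹) (.inr (by positivity))
  rw [Real.zero_rpow (by positivity)] at h'
  refine tendsto_zero_iff_norm_tendsto_zero.2 (h'.congr fun x => ?_)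
  rw [Real.rpow_rpow_inv (norm_nonneg _) hp0.ne']

section Dual

/-- The coefficients of a functional on `l^p` belong to the dual sequence space. -/
theorem memLp_dual_apply_single {q : ℝ≥0∞} (hpq : p.toReal.HolderConjugate q.toReal)
    (φ : StrongDual ℂ (LatticeLp N p)) :
    Memℓp (fun x : IntLattice N => φ (lp.single p x 1)) q := by
  have hp0 := hpq.pos
  have hq0 := hpq.symm.pos
  refine memℓp_gen' (C := ‖φ‖ ^ q.toReal) fun F => ?_
  set b : IntLattice N → ℂ := fun x => φ (lp.single p x 1)
  obtain ⟨⟨g, hg, hgb⟩, -⟩ := NNReal.isGreatest_Lp F (fun x => ‖b x‖₊) hpq.symm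
  have hs (x) : ∃ s : ℂ, ‖s‖ ≤ 1 ∧ s * b x = (‖b x‖ : ℂ) := by
    by_cases h : b x = 0
    · exact ⟨0, by simp, by simp [h]⟩
    · refine ⟨‖b x‖ / b x, ?_, by field_simp⟩
      rw [norm_div, Complex.norm_real, norm_norm]
      exact div_self_le_one _
  choose s hs1 hsb using hs
  let u : LatticeLp N p := ∑ x ∈ F, lp.single p x (s x * g x)
  have hu : ‖u‖ ≤ 1 := by
    have h : ‖u‖ ^ p.toReal ≤ 1 := by
      rw [lp.norm_sum_single hp0 (fun x => s x * (g x : ℂ)) F]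
      refine le_trans (Finset.sum_le_sum fun x _ => ?_) (b := ∑ x ∈ F, (g x : ℝ) ^ p.toReal) ?_
      · refine Real.rpow_le_rpow (norm_nonneg _) ?_ hp0.le
        rw [norm_mul, Complex.norm_real, NNReal.norm_eq]
        exact mul_le_of_le_one_left (g x).2 (hs1 x)
      · exact_mod_cast hg
    by_contra hlt
    exact absurd h (not_le.2 (Real.one_lt_rpow (not_le.1 hlt) hp0))
  have hφu : φ u = ((∑ x ∈ F, ‖b x‖ ^ q.toReal) ^ (1 / q.toReal) : ℝ) := by
    have h1 : φ u = ∑ x ∈ F, ((‖b x‖ * g x : ℝ) : ℂ) := by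
      simp only [u, map_sum]
      refine Finset.sum_congr rfl fun x _ => ?_
      rw [← mul_one (s x * g x), ← smul_eq_mul (s x * (g x : ℂ)) 1, lp.single_smul, map_smul,
        smul_eq_mul, Complex.ofReal_mul, ← hsb]
      ring
    rw [h1, ← Complex.ofReal_sum]
    congr 1
    have := congrArg NNReal.toReal hgb
    push_cast at this
    simpa using this
  have hle : (∑ x ∈ F, ‖b x‖ ^ q.toReal) ^ (1 / q.toReal) ≤ ‖φ‖ := by
    have h := φ.le_of_opNorm_le_of_le le_rfl hu
    rw [hφu, Complex.norm_real, mul_one, Real.norm_of_nonneg (by positivity)] at h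
    exact h
  have h := Real.rpow_le_rpow (by positivity) hle hq0.le
  rwa [one_div, Real.rpow_inv_rpow (by positivity) hq0.ne'] at h

/-- Functionals on `l^p`, `1 < p < ∞`, have small tails. -/
theorem tendsto_dual_comp_indicatorLp_compl (hp : 1 < p) (hp' : p < ∞)
    (φ : StrongDual ℂ (LatticeLp N p)) :
    Tendsto (fun F : Finset (IntLattice N) => φ ∘L mulOp (indicatorLp (F : Set (IntLattice N))ᶜ))
      atTop (𝓝 0) := by
  let q : ℝ≥0∞ := .ofReal p.toReal.conjExponent
  have hp1 : 1 < p.toReal := by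
    rwa [← ENNReal.toReal_one, ENNReal.toReal_lt_toReal ENNReal.one_ne_top hp'.ne]
  have hpq : p.toReal.HolderConjugate q.toReal := by
    have h := Real.HolderConjugate.conjExponent hp1
    rwa [← ENNReal.toReal_ofReal h.symm.nonneg] at h
  have : Fact (1 ≤ q) := ⟨by
    rw [← ENNReal.ofReal_one]
    exact ENNReal.ofReal_le_ofReal (Real.HolderConjugate.conjExponent hp1).symm.lt.le⟩
  let b : LatticeLp N q := ⟨_, memLp_dual_apply_single hpq φ⟩
  have htail := tendsto_mulOp_indicatorLp_compl ENNReal.ofReal_ne_top b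
  refine squeeze_zero_norm (fun F => ?_) (tendsto_zero_iff_norm_tendsto_zero.1 htail)
  refine ContinuousLinearMap.opNorm_le_bound _ (norm_nonneg _) fun u => ?_
  set t := mulOp (indicatorLp (F : Set (IntLattice N))ᶜ) b with ht
  have hsum : HasSum (fun x => u x * t x)
      (φ (mulOp (indicatorLp (F : Set (IntLattice N))ᶜ) u)) := by
    have h := (lp.hasSum_single hp'.ne
      (mulOp (indicatorLp (F : Set (IntLattice N))ᶜ) u)).mapL φ
    refine h.congr_fun fun x => ?_
    rw [← mul_one (mulOp _ u x), ← smul_eq_mul _ (1 : ℂ), lp.single_smul, map_smul, ht]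
    simp only [mulOp_apply, smul_eq_mul]
    change _ = _ * b x
    ring
  obtain ⟨h1, h2⟩ := lp.tsum_mul_le_mul_norm hpq u t
  rw [ContinuousLinearMap.comp_apply, ← hsum.tsum_eq, mul_comm ‖t‖]
  simp only [← norm_mul] at h1 h2
  exact (norm_tsum_le_tsum_norm h1).trans h2

end Dual

section Convergence

variable {ι : Type*} {l : Filter ι}

theorem tendsto_mulOp_apply_zero (hp : p ≠ ∞) {d : ι → LatticeLp N ∞} {C : ℝ}
    (hd : ∀ i, ‖d i‖ ≤ C) (h0 : ∀ x, Tendsto (fun i => d i x) l (𝓝 0)) (u : LatticeLp N p) :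
    Tendsto (fun i => mulOp (d i) u) l (𝓝 0) := by
  rcases isEmpty_or_nonempty ι with hι | ⟨⟨i₀⟩⟩
  · exact (Filter.tendsto_of_isEmpty)
  have hC : 0 ≤ C := (norm_nonneg _).trans (hd i₀)
  refine tendsto_zero_iff_norm_tendsto_zero.2 (tendsto_order.2 ⟨fun r hr =>
    .of_forall fun i => hr.trans_le (norm_nonneg _), fun ε hε => ?_⟩)
  have htail := ((tendsto_mulOp_indicatorLp_compl hp u).norm.const_mul C)
  rw [norm_zero, mul_zero] at htail
  obtain ⟨F, hF⟩ := (htail.eventually (gt_mem_nhds (half_pos hε))).exists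
  have hsum : Tendsto (fun i => ∑ x ∈ F, ‖mulOp (d i) u x‖) l (𝓝 0) := by
    rw [← Finset.sum_const_zero (s := F)]
    refine tendsto_finsetSum _ fun x _ => ?_
    have := ((h0 x).mul_const (u x)).norm
    simpa using this
  filter_upwards [hsum.eventually (gt_mem_nhds (half_pos hε))] with i hi
  rw [← mulOp_indicatorLp_add_compl (F : Set (IntLattice N)) (mulOp (d i) u)]
  have h2 : mulOp (indicatorLp (F : Set (IntLattice N))ᶜ) (mulOp (d i) u) =
      mulOp (d i) (mulOp (indicatorLp (F : Set (IntLattice N))ᶜ) u) := by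
    ext x
    simp only [mulOp_apply]
    ring
  calc _ ≤ _ := norm_add_le _ _
    _ < ε / 2 + ε / 2 := add_lt_add_of_le_of_lt
      ((norm_mulOp_indicatorLp_finset_le _ _).trans hi.le) ?_
    _ = ε := add_halves ε
  rw [h2]
  exact ((mulOp (d i)).le_of_opNorm_le ((norm_mulOp_le _).trans (hd i)) _).trans_lt hF

theorem tendsto_dual_comp_mulOp_zero (hp : 1 < p) (hp' : p < ∞) {d : ι → LatticeLp N ∞} {C : ℝ}
    (hd : ∀ i, ‖d i‖ ≤ C) (h0 : ∀ x, Tendsto (fun i => d i x) l (𝓝 0))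
    (φ : StrongDual ℂ (LatticeLp N p)) :
    Tendsto (fun i => φ ∘L mulOp (d i)) l (𝓝 0) := by
  rcases isEmpty_or_nonempty ι with hι | ⟨⟨i₀⟩⟩
  · exact (Filter.tendsto_of_isEmpty)
  have hC : 0 ≤ C := (norm_nonneg _).trans (hd i₀)
  refine tendsto_zero_iff_norm_tendsto_zero.2 (tendsto_order.2 ⟨fun r hr =>
    .of_forall fun i => hr.trans_le (norm_nonneg _), fun ε hε => ?_⟩)
  have htail := ((tendsto_dual_comp_indicatorLp_compl hp hp' φ).norm.mul_const C)
  rw [norm_zero, zero_mul] at htail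
  obtain ⟨F, hF⟩ := (htail.eventually (gt_mem_nhds (half_pos hε))).exists
  have hsum : Tendsto (fun i => ‖φ‖ * ∑ x ∈ F, ‖d i x‖) l (𝓝 0) := by
    have : Tendsto (fun i => ∑ x ∈ F, ‖d i x‖) l (𝓝 0) := by
      rw [← Finset.sum_const_zero (s := F)]
      refine tendsto_finsetSum _ fun x _ => ?_
      simpa using (h0 x).norm
    simpa using this.const_mul ‖φ‖
  filter_upwards [hsum.eventually (gt_mem_nhds (half_pos hε))] with i hi
  have hsplit : φ ∘L mulOp (d i) =
      φ ∘L mulOp (indicatorLp (F : Set (IntLattice N)) * d i) +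
        φ ∘L mulOp (indicatorLp (F : Set (IntLattice N))ᶜ) ∘L mulOp (d i) := by
    ext u
    simp only [add_apply, ContinuousLinearMap.comp_apply, ← map_add]
    congr 1
    conv_lhs => rw [← mulOp_indicatorLp_add_compl (F : Set (IntLattice N)) (mulOp (d i) u)]
    congr 1
    ext x
    simp only [mulOp_apply, lp.infty_coeFn_mul, Pi.mul_apply, mul_assoc]
  rw [hsplit]
  calc _ ≤ _ := norm_add_le _ _
    _ < ε / 2 + ε / 2 := add_lt_add_of_le_of_lt (le_trans ?_ hi.le) (lt_of_le_of_lt ?_ hF)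
    _ = ε := add_halves ε
  · refine (ContinuousLinearMap.opNorm_comp_le _ _).trans
      (mul_le_mul_of_nonneg_left ((norm_mulOp_le _).trans ?_) (norm_nonneg _))
    exact norm_mulOp_indicatorLp_finset_le F (d i)
  · rw [← ContinuousLinearMap.comp_assoc]
    exact (ContinuousLinearMap.opNorm_comp_le _ _).trans
      (mul_le_mul_of_nonneg_left ((norm_mulOp_le _).trans (hd i)) (norm_nonneg _))

/-- Translates going to infinity converge weakly to zero. -/
theorem tendsto_dual_apply_shift (hp : 1 < p) (hp' : p < ∞) {h : ℕ → IntLattice N}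
    (hh : Tendsto h atTop cofinite) (φ : StrongDual ℂ (LatticeLp N p)) (u : LatticeLp N p) :
    Tendsto (fun j => φ (shift (h j) u)) atTop (𝓝 0) := by
  refine tendsto_zero_iff_norm_tendsto_zero.2 (tendsto_order.2 ⟨fun r hr =>
    .of_forall fun i => hr.trans_le (norm_nonneg _), fun ε hε => ?_⟩)
  have htail := ((tendsto_dual_comp_indicatorLp_compl hp hp' φ).norm.mul_const ‖u‖)
  rw [norm_zero, zero_mul] at htail
  obtain ⟨F, hF⟩ := (htail.eventually (gt_mem_nhds (half_pos hε))).exists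
  have hsum : Tendsto (fun j => ‖φ‖ * ∑ x ∈ F, ‖shift (h j) u x‖) atTop (𝓝 0) := by
    have : Tendsto (fun j => ∑ x ∈ F, ‖shift (h j) u x‖) atTop (𝓝 0) := by
      rw [← Finset.sum_const_zero (s := F)]
      refine tendsto_finsetSum _ fun x _ => ?_
      have hx : Tendsto (fun j => x - h j) atTop cofinite :=
        (sub_right_injective (b := x)).tendsto_cofinite.comp hh
      simpa using ((tendsto_cofinite_zero hp'.ne u).comp hx).norm
    simpa using this.const_mul ‖φ‖
  filter_upwards [hsum.eventually (gt_mem_nhds (half_pos hε))] with j hj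
  rw [← mulOp_indicatorLp_add_compl (F : Set (IntLattice N)) (shift (h j) u), map_add]
  calc _ ≤ _ := norm_add_le _ _
    _ < ε / 2 + ε / 2 := add_lt_add_of_le_of_lt (le_trans ?_ hj.le) (lt_of_le_of_lt ?_ hF)
    _ = ε := add_halves ε
  · exact φ.le_of_opNorm_le_of_le le_rfl (norm_mulOp_indicatorLp_finset_le F _)
  · have := (φ ∘L mulOp (indicatorLp (F : Set (IntLattice N))ᶜ)).le_opNorm (shift (h j) u)
    rwa [norm_shift_apply] at this

end Convergence

end LatticeOp

namespace LatticeOp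

variable {N : ℕ} {p : ℝ≥0∞} [Fact (1 ≤ p)] {a : IntLattice N → LatticeLp N ∞}
  {c : IntLattice N → ℂ}

theorem hasSum_smul_shift (hc : Summable fun α => ‖c α‖) :
    HasSum (fun α => c α • (shift α : LatticeLp N p →L[ℂ] LatticeLp N p))
      (∑' α, c α • shift α) := by
  refine (Summable.of_norm_bounded hc fun α => ?_).hasSum
  rw [norm_smul]
  exact mul_le_of_le_one_right (norm_nonneg _) (norm_shift_le α)

theorem hasSum_smul_shift_apply (hc : Summable fun α => ‖c α‖) (u : LatticeLp N p) :
    HasSum (fun α => c α • shift α u)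
      ((∑' α, c α • shift α : LatticeLp N p →L[ℂ] LatticeLp N p) u) :=
  (hasSum_smul_shift hc).mapL (ContinuousLinearMap.apply ℂ (LatticeLp N p) u)

theorem tsum_smul_shift_single (hc : Summable fun α => ‖c α‖) (x y : IntLattice N) :
    (∑' α, c α • shift α : LatticeLp N p →L[ℂ] LatticeLp N p) (lp.single p y 1) x = c (x - y) := by
  have h := (hasSum_smul_shift_apply hc (lp.single p y 1)).mapL
    (lp.evalCLM ℂ (fun _ : IntLattice N => ℂ) p x)
  refine h.unique ?_
  have h' := hasSum_single (f := fun α => c α * (lp.single p y 1 : LatticeLp N p) (x - α)) (x - y)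
    fun α hα => ?_
  · change HasSum (fun α => c α * (lp.single p y 1 : LatticeLp N p) (x - α)) _
    simpa using h'
  · have : x - α ≠ y := fun h => hα (by rw [← h, sub_sub_cancel])
    simp [this]

theorem HasConstantDiagonals.coeff_eq {B : LatticeLp N p →L[ℂ] LatticeLp N p}
    (h : HasConstantDiagonals B c) (α : IntLattice N) : c α = B (lp.single p 0 1) α := by
  rw [h.2, tsum_smul_shift_single h.1, sub_zero]

theorem conjShift_wienerOp_single (ha : Summable fun α => ‖a α‖) (g x y : IntLattice N) :
    conjShift (wienerOp p a) g (lp.single p y 1) x = a (x - y) (x + g) := by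
  have h := hasSum_wienerOp_apply ha (shift g (lp.single p y (1 : ℂ))) (x - -g)
  refine h.unique ?_
  have h' := hasSum_single
    (f := fun α => a α (x - -g) * shift g (lp.single p y (1 : ℂ)) (x - -g - α)) (x - y)
    fun α hα => ?_
  · simpa [sub_eq_add_neg, add_comm, add_left_comm] using h'
  · have : x + g - α - g ≠ y := fun h => hα (by rw [← h]; abel)
    simp [this]

section LimitOperator

variable {g : ℕ → IntLattice N} {B : LatticeLp N p →L[ℂ] LatticeLp N p}

theorem IsLimitOperator.tendsto_coeff (ha : Summable fun α => ‖a α‖)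
    (hB : IsLimitOperator (wienerOp p a) g B) (α x : IntLattice N) :
    Tendsto (fun j => a α (x + g j)) atTop (𝓝 (B (lp.single p (x - α) 1) x)) := by
  have h := ((lp.evalCLM ℂ (fun _ : IntLattice N => ℂ) p x).continuous.tendsto _).comp
    (hB.tendsto_apply (lp.single p (x - α) 1))
  refine h.congr fun j => ?_
  refine (conjShift_wienerOp_single ha (g j) x (x - α)).trans ?_
  rw [sub_sub_cancel]

theorem SlowlyOscillating.tendsto_translate {f : IntLattice N → ℂ} (hf : SlowlyOscillating f)
    (hg : Tendsto g atTop cofinite) {x : IntLattice N} {z : ℂ}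
    (h : Tendsto (fun j => f (x + g j)) atTop (𝓝 z)) (y : IntLattice N) :
    Tendsto (fun j => f (y + g j)) atTop (𝓝 z) := by
  have hx : Tendsto (fun j => x + g j) atTop cofinite :=
    (add_right_injective x).tendsto_cofinite.comp hg
  have h' := ((hf (y - x)).comp hx).add h
  rw [zero_add] at h'
  refine h'.congr fun j => ?_
  rw [Function.comp_apply, sub_add_cancel, show x + g j + (y - x) = y + g j by abel]

theorem IsLimitOperator.tendsto_const (ha : Summable fun α => ‖a α‖)
    (hso : ∀ α, SlowlyOscillating (a α)) (hB : IsLimitOperator (wienerOp p a) g B)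
    (α x : IntLattice N) :
    Tendsto (fun j => a α (x + g j)) atTop (𝓝 (B (lp.single p 0 1) α)) := by
  have h := hB.tendsto_coeff ha α α
  rw [sub_self] at h
  exact (hso α).tendsto_translate hB.tendsto_infinity h x

theorem norm_le_of_tendsto_coeff {α x : IntLattice N} {z : ℂ}
    (h : Tendsto (fun j => a α (x + g j)) atTop (𝓝 z)) : ‖z‖ ≤ ‖a α‖ :=
  le_of_tendsto h.norm (.of_forall fun _ => lp.norm_apply_le_norm (by simp) _ _)

/-- Limit operators of operators with slowly oscillating coefficients have constant diagonals. -/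
theorem IsLimitOperator.hasConstantDiagonals (hp : p ≠ ∞) (ha : Summable fun α => ‖a α‖)
    (hso : ∀ α, SlowlyOscillating (a α)) (hB : IsLimitOperator (wienerOp p a) g B) :
    HasConstantDiagonals B fun α => B (lp.single p 0 1) α := by
  have hc : Summable fun α => ‖B (lp.single p 0 1) α‖ :=
    Summable.of_nonneg_of_le (fun _ => norm_nonneg _)
      (fun α => norm_le_of_tendsto_coeff (hB.tendsto_const ha hso α 0)) ha
  refine ⟨hc, lp.ext_continuousLinearMap hp fun y => ?_⟩
  ext x
  change B (lp.single p y 1) x = _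
  refine Eq.trans ?_ (tsum_smul_shift_single hc x y).symm
  refine tendsto_nhds_unique ?_ (hB.tendsto_const ha hso (x - y) x)
  have := hB.tendsto_coeff ha (x - y) x
  rwa [sub_sub_cancel] at this

theorem hasSum_conjShift_wienerOp (ha : Summable fun α => ‖a α‖) (g : IntLattice N) :
    HasSum (fun α => (mulOp (shift (-g) (a α)) ∘L shift α : LatticeLp N p →L[ℂ] LatticeLp N p))
      (conjShift (wienerOp p a) g) := by
  have h := (hasSum_wienerOp (p := p) ha).map
    ((AddMonoidHom.mulLeft (shift (-g) : LatticeLp N p →L[ℂ] LatticeLp N p)).comp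
      (AddMonoidHom.mulRight (shift g))) (by
        exact (continuous_const_mul _).comp (continuous_mul_const _))
  refine h.congr_fun fun α => ?_
  change mulOp (shift (-g) (a α)) * shift α = shift (-g) * (mulOp (a α) * shift α * shift g)
  rw [mul_assoc, ← mul_assoc, shift_mul_mulOp, mul_assoc, ← shift_add, ← shift_add]
  congr 2
  abel

theorem tendsto_dev_coeff (hso : ∀ α, SlowlyOscillating (a α)) (hg : Tendsto g atTop cofinite)
    (hc : ∀ α, Tendsto (fun j => a α (g j)) atTop (𝓝 (c α))) (α x : IntLattice N) :
    Tendsto (fun j => (shift (-g j) (a α) - algebraMap ℂ (LatticeLp N ∞) (c α)) x) atTop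
      (𝓝 0) := by
  have h := (hso α).tendsto_translate hg (x := 0) (by simpa using hc α) x
  have h' := h.sub_const (c α)
  rw [sub_self] at h'
  refine h'.congr fun j => ?_
  change _ = a α (x - -g j) - algebraMap ℂ (LatticeLp N ∞) (c α) x
  rw [sub_neg_eq_add, Algebra.algebraMap_eq_smul_one]
  simp

theorem norm_dev_coeff_le (α : IntLattice N) (j : ℕ) :
    ‖shift (-g j) (a α) - algebraMap ℂ (LatticeLp N ∞) (c α)‖ ≤ ‖a α‖ + ‖c α‖ := by
  refine (norm_sub_le _ _).trans ?_
  rw [norm_shift_apply, norm_algebraMap']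

theorem mulOp_eq_dev_add (α : IntLattice N) (j : ℕ) :
    (mulOp (shift (-g j) (a α)) : LatticeLp N p →L[ℂ] LatticeLp N p) =
      mulOp (shift (-g j) (a α) - algebraMap ℂ (LatticeLp N ∞) (c α)) +
        c α • ContinuousLinearMap.id ℂ _ := by
  rw [← mulHom_apply, ← mulHom_apply, map_sub, AlgHom.commutes, Algebra.algebraMap_eq_smul_one]
  exact (sub_add_cancel _ _).symm

/-- If all coefficients converge along `g`, then `g` defines a limit operator. -/
theorem isLimitOperator_of_tendsto (hp : 1 < p) (hp' : p < ∞) (ha : Summable fun α => ‖a α‖)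
    (hso : ∀ α, SlowlyOscillating (a α)) (hg : Tendsto g atTop cofinite)
    (hc : ∀ α, Tendsto (fun j => a α (g j)) atTop (𝓝 (c α))) :
    (Summable fun α => ‖c α‖) ∧ IsLimitOperator (wienerOp p a) g (∑' α, c α • shift α) := by
  have hcs : Summable fun α => ‖c α‖ :=
    Summable.of_nonneg_of_le (fun _ => norm_nonneg _)
      (fun α => norm_le_of_tendsto_coeff (x := 0) (g := g) (by simpa using hc α)) ha
  have hshift (α : IntLattice N) (j : ℕ) : ‖shift (-g j) (a α)‖ = ‖a α‖ := norm_shift_apply _ _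
  refine ⟨hcs, hg, fun u => ?_, fun φ => ?_⟩
  · have h1 (j : ℕ) := (hasSum_conjShift_wienerOp (p := p) ha (g j)).mapL
      (ContinuousLinearMap.apply ℂ (LatticeLp N p) u)
    have h2 := hasSum_smul_shift_apply (p := p) hcs u
    rw [← h2.tsum_eq]
    refine (tendsto_tsum_of_dominated_convergence (ha.mul_right ‖u‖) (fun α => ?_)
      (.of_forall fun j α => ?_)).congr fun j => (h1 j).tsum_eq
    · have h := (tendsto_mulOp_apply_zero hp'.ne (norm_dev_coeff_le (a := a) (c := c) α)
        (tendsto_dev_coeff hso hg hc α) (shift α u)).add_const (c α • shift α u)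
      rw [zero_add] at h
      refine h.congr fun j => ?_
      change _ = mulOp (shift (-g j) (a α)) (shift α u)
      rw [mulOp_eq_dev_add (c := c)]
      rfl
    · change ‖mulOp (shift (-g j) (a α)) (shift α u)‖ ≤ _
      refine ((mulOp _).le_of_opNorm_le (norm_mulOp_le _) _).trans ?_
      rw [norm_shift_apply, norm_shift_apply]
  · have h1 (j : ℕ) := (hasSum_conjShift_wienerOp (p := p) ha (g j)).mapL
      (ContinuousLinearMap.postcomp (LatticeLp N p) φ)
    have h2 := (hasSum_smul_shift (p := p) hcs).mapL
      (ContinuousLinearMap.postcomp (LatticeLp N p) φ)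
    change Tendsto _ _ (𝓝 (ContinuousLinearMap.postcomp (LatticeLp N p) φ (∑' α, c α • shift α)))
    rw [← h2.tsum_eq]
    refine (tendsto_tsum_of_dominated_convergence (ha.mul_left ‖φ‖) (fun α => ?_)
      (.of_forall fun j α => ?_)).congr fun j => (h1 j).tsum_eq
    · have h := tendsto_dual_comp_mulOp_zero hp hp' (norm_dev_coeff_le (a := a) (c := c) α)
        (tendsto_dev_coeff hso hg hc α) φ
      have h' := ((ContinuousLinearMap.precomp ℂ
        (shift α : LatticeLp N p →L[ℂ] LatticeLp N p)).continuous.tendsto _).comp h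
      rw [map_zero] at h'
      have h3 := h'.add_const (φ ∘L (c α • shift α))
      rw [zero_add] at h3
      refine h3.congr fun j => ?_
      ext u
      change φ _ + φ _ = φ (mulOp (shift (-g j) (a α)) (shift α u))
      rw [mulOp_eq_dev_add (c := c), ← map_add]
      rfl
    · change ‖φ ∘L (mulOp (shift (-g j) (a α)) ∘L shift α)‖ ≤ _
      refine (ContinuousLinearMap.opNorm_comp_le _ _).trans
        (mul_le_mul_of_nonneg_left ?_ (norm_nonneg _))
      rw [← hshift α j]
      exact norm_mulOp_comp_shift_le _ _

variable (a) in
/-- Every sequence has a subsequence along which all coefficients converge. -/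
theorem exists_subseq_tendsto_coeff (g : ℕ → IntLattice N) :
    ∃ c : IntLattice N → ℂ, ∃ k : ℕ → ℕ, StrictMono k ∧
      ∀ α, Tendsto (fun j => a α (g (k j))) atTop (𝓝 (c α)) := by
  have hK : IsCompact (univ.pi fun α : IntLattice N => Metric.closedBall (0 : ℂ) ‖a α‖) :=
    isCompact_univ_pi fun α => isCompact_closedBall _ _
  obtain ⟨c, -, k, hk, h⟩ := hK.tendsto_subseq (x := fun j α => a α (g j)) fun j α _ => by
    rw [mem_closedBall_zero_iff]
    exact lp.norm_apply_le_norm (by simp) _ _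
  exact ⟨c, k, hk, fun α => (tendsto_pi_nhds.1 h α)⟩

end LimitOperator

end LatticeOp

namespace LatticeOp

variable {N : ℕ} {p : ℝ≥0∞} [Fact (1 ≤ p)] {c : IntLattice N → ℂ}

theorem summable_prod_pi {N : ℕ} {f : ℤ → ℝ} (hf : Summable f) (h0 : ∀ n, 0 ≤ f n) :
    Summable fun x : IntLattice N => ∏ i, f (x i) := by
  classical
  refine summable_of_sum_le (c := ∏ _i : Fin N, ∑' n, f n)
    (fun x => Finset.prod_nonneg fun i _ => h0 _) fun u => ?_
  calc ∑ x ∈ u, ∏ i, f (x i)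
      ≤ ∑ x ∈ Fintype.piFinset fun i => u.image fun x => x i, ∏ i, f (x i) :=
        Finset.sum_le_sum_of_subset_of_nonneg
          (fun x hx => Fintype.mem_piFinset.2 fun i => Finset.mem_image_of_mem _ hx)
          fun x _ _ => Finset.prod_nonneg fun i _ => h0 _
    _ = ∏ i : Fin N, ∑ n ∈ u.image fun x => x i, f n := (Finset.prod_univ_sum _ _).symm
    _ ≤ _ := Finset.prod_le_prod (fun i _ => Finset.sum_nonneg fun n _ => h0 n)
        fun i _ => hf.sum_le_tsum _ fun n _ => h0 n

theorem summable_exp_neg_mul_abs {r : ℝ} (hr : 0 < r) :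
    Summable fun n : ℤ => Real.exp (-(r * |(n : ℝ)|)) := by
  have h := Real.summable_exp_nat_mul_iff.2 (neg_lt_zero.2 hr)
  refine Summable.of_nat_of_neg (h.congr fun n => ?_) (h.congr fun n => ?_)
  all_goals
    congr 1
    simp
    ring

/-- The modulated weight `x ↦ t^x e^{-ε|x|}`. -/
def expWeight (t : Fin N → Circle) (ε : ℝ) (x : IntLattice N) : ℂ :=
  (∏ i, (t i : ℂ) ^ x i) * Real.exp (-(ε * ∑ i, |(x i : ℝ)|))

theorem norm_prod_circle_zpow (t : Fin N → Circle) (x : IntLattice N) :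
    ‖∏ i, (t i : ℂ) ^ x i‖ = 1 := by
  rw [norm_prod]
  exact Finset.prod_eq_one fun i _ => by rw [norm_zpow, Circle.norm_coe, one_zpow]

theorem norm_prod_circle_zpow_neg (t : Fin N → Circle) (x : IntLattice N) :
    ‖∏ i, (t i : ℂ) ^ (-x i)‖ = 1 :=
  norm_prod_circle_zpow t (-x)

theorem prod_circle_zpow_add (t : Fin N → Circle) (x y : IntLattice N) :
    ∏ i, (t i : ℂ) ^ (x + y) i = (∏ i, (t i : ℂ) ^ x i) * ∏ i, (t i : ℂ) ^ y i := by
  rw [← Finset.prod_mul_distrib]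
  exact Finset.prod_congr rfl fun i _ => zpow_add₀ (Circle.coe_ne_zero _) _ _

theorem norm_expWeight (t : Fin N → Circle) (ε : ℝ) (x : IntLattice N) :
    ‖expWeight t ε x‖ = Real.exp (-(ε * ∑ i, |(x i : ℝ)|)) := by
  rw [expWeight, norm_mul, norm_prod_circle_zpow, one_mul, Complex.norm_real,
    Real.norm_of_nonneg (Real.exp_pos _).le]

omit [Fact (1 ≤ p)] in
theorem memLp_expWeight (hp : 0 < p.toReal) (t : Fin N → Circle) {ε : ℝ} (hε : 0 < ε) :
    Memℓp (expWeight t ε) p := by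
  refine memℓp_gen ?_
  refine (summable_prod_pi (summable_exp_neg_mul_abs (mul_pos hp hε))
    fun n => (Real.exp_pos _).le).congr fun x => ?_
  rw [norm_expWeight, ← Real.exp_mul, ← Real.exp_sum, Finset.sum_neg_distrib, ← Finset.mul_sum]
  congr 1
  ring

theorem norm_expWeight_sub_le (t : Fin N → Circle) {ε : ℝ} (hε : 0 < ε) (x α : IntLattice N) :
    ‖expWeight t ε (x - α) - (∏ i, (t i : ℂ) ^ (-α i)) * expWeight t ε x‖ ≤
      (Real.exp (ε * ∑ i, |(α i : ℝ)|) - 1) * ‖expWeight t ε x‖ := by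
  have h1 : expWeight t ε (x - α) - (∏ i, (t i : ℂ) ^ (-α i)) * expWeight t ε x =
      (∏ i, (t i : ℂ) ^ (x - α) i) * ((Real.exp (-(ε * ∑ i, |((x - α) i : ℝ)|)) -
        Real.exp (-(ε * ∑ i, |(x i : ℝ)|)) : ℝ) : ℂ) := by
    have h := prod_circle_zpow_add t x (-α)
    rw [← sub_eq_add_neg] at h
    simp only [Pi.neg_apply] at h
    simp only [expWeight, h]
    push_cast
    ring
  rw [h1, norm_mul, norm_prod_circle_zpow, one_mul, Complex.norm_real, norm_expWeight,
    Real.norm_eq_abs]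
  set s := ∑ i, |(x i : ℝ)|
  set s' := ∑ i, |((x - α) i : ℝ)|
  set d := ∑ i, |(α i : ℝ)|
  have hle : s ≤ s' + d := by
    rw [← Finset.sum_add_distrib]
    refine Finset.sum_le_sum fun i _ => ?_
    have := abs_add_le ((x - α) i : ℝ) (α i)
    simpa using this
  have hle' : s' ≤ s + d := by
    rw [← Finset.sum_add_distrib]
    refine Finset.sum_le_sum fun i _ => ?_
    have := abs_sub (x i : ℝ) (α i)
    simpa using this
  have e1 : Real.exp (-(ε * s')) ≤ Real.exp (ε * d) * Real.exp (-(ε * s)) := by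
    rw [← Real.exp_add]
    exact Real.exp_le_exp.2 (by nlinarith)
  have e2 : Real.exp (-(ε * s)) ≤ Real.exp (ε * d) * Real.exp (-(ε * s')) := by
    rw [← Real.exp_add]
    exact Real.exp_le_exp.2 (by nlinarith)
  have e3 : 1 ≤ Real.exp (ε * d) :=
    Real.one_le_exp (mul_nonneg hε.le (Finset.sum_nonneg fun i _ => abs_nonneg _))
  rw [abs_le]
  constructor
  · rcases le_total (Real.exp (-(ε * s))) (Real.exp (-(ε * s'))) with h | h <;>
      nlinarith [Real.exp_pos (-(ε * s))]
  · linarith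

theorem summable_symbol (hc : Summable fun α => ‖c α‖) (t : Fin N → Circle) :
    Summable fun α => c α * ∏ i, (t i : ℂ) ^ (-α i) :=
  Summable.of_norm_bounded hc fun α => by
    rw [norm_mul]
    exact (mul_le_of_le_one_right (norm_nonneg _) (norm_prod_circle_zpow_neg t α).le)

/-- The values of the symbol are approximate eigenvalues. -/
theorem exists_norm_sub_symbol_smul_le (hp : p ≠ ∞) (hc : Summable fun α => ‖c α‖)
    (t : Fin N → Circle) {δ : ℝ} (hδ : 0 < δ) :
    ∃ u : LatticeLp N p, u ≠ 0 ∧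
      ‖(∑' α, c α • shift α : LatticeLp N p →L[ℂ] LatticeLp N p) u - symbol c t • u‖ ≤
        δ * ‖u‖ := by
  have hp0 : 0 < p.toReal := ENNReal.toReal_pos pos_of_one_le.ne' hp
  have hlim : Tendsto (fun ε : ℝ => ∑' α : IntLattice N,
      ‖c α‖ * min 2 (Real.exp (ε * ∑ i, |(α i : ℝ)|) - 1)) (𝓝[>] 0) (𝓝 0) := by
    have h0 : ∑' α : IntLattice N,
        ‖c α‖ * min (2 : ℝ) (Real.exp (0 * ∑ i, |(α i : ℝ)|) - 1) = 0 := by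
      simp
    conv => enter [3, 1]; rw [← h0]
    refine tendsto_tsum_of_dominated_convergence (hc.mul_right 2) (fun α => ?_) ?_
    · have : Continuous fun ε : ℝ => ‖c α‖ * min 2 (Real.exp (ε * ∑ i, |(α i : ℝ)|) - 1) := by
        fun_prop
      exact (this.tendsto 0).mono_left nhdsWithin_le_nhds
    · filter_upwards [self_mem_nhdsWithin] with ε hε α
      have : 0 ≤ Real.exp (ε * ∑ i, |(α i : ℝ)|) - 1 := sub_nonneg.2 (Real.one_le_exp
        (mul_nonneg (mem_Ioi.1 hε).le (Finset.sum_nonneg fun i _ => abs_nonneg _)))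
      rw [Real.norm_of_nonneg (by positivity)]
      exact mul_le_mul_of_nonneg_left (min_le_left _ _) (norm_nonneg _)
  obtain ⟨ε, hεδ, hε⟩ := ((hlim.eventually (gt_mem_nhds hδ)).and self_mem_nhdsWithin).exists
  have hε : 0 < ε := hε
  let u : LatticeLp N p := ⟨expWeight t ε, memLp_expWeight hp0 t hε⟩
  have hu : u ≠ 0 := fun h => by
    have h' : expWeight t ε 0 = 0 := congrArg (fun v : LatticeLp N p => v 0) h
    have := norm_expWeight t ε 0
    rw [h', norm_zero] at this
    exact (Real.exp_pos _).ne this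
  refine ⟨u, hu, ?_⟩
  have hterm (α : IntLattice N) : ‖shift α u - (∏ i, (t i : ℂ) ^ (-α i)) • u‖ ≤
      min 2 (Real.exp (ε * ∑ i, |(α i : ℝ)|) - 1) * ‖u‖ := by
    rw [min_mul_of_nonneg _ _ (norm_nonneg u)]
    refine le_min ?_ ?_
    · refine (norm_sub_le _ _).trans_eq ?_
      rw [norm_shift_apply, norm_smul, norm_prod_circle_zpow_neg t α]
      ring
    · have h0 : 0 ≤ Real.exp (ε * ∑ i, |(α i : ℝ)|) - 1 := sub_nonneg.2 (Real.one_le_exp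
        (mul_nonneg hε.le (Finset.sum_nonneg fun i _ => abs_nonneg _)))
      have := lp.norm_mono pos_of_one_le.ne'
        (x := shift α u - (∏ i, (t i : ℂ) ^ (-α i)) • u)
        (y := ((Real.exp (ε * ∑ i, |(α i : ℝ)|) - 1 : ℝ) : ℂ) • u) fun x => by
          refine (norm_expWeight_sub_le t hε x α).trans_eq ?_
          rw [lp.coeFn_smul, Pi.smul_apply, norm_smul, Complex.norm_real, Real.norm_of_nonneg h0]
      rwa [norm_smul, Complex.norm_real, Real.norm_of_nonneg h0] at this
  have hsum := (hasSum_smul_shift_apply hc u).sub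
    ((summable_symbol hc t).hasSum.smul_const u)
  have hbound : Summable fun α : IntLattice N =>
      ‖c α‖ * min 2 (Real.exp (ε * ∑ i, |(α i : ℝ)|) - 1) := by
    refine Summable.of_nonneg_of_le (fun α => ?_) (fun α => ?_) (hc.mul_right 2)
    · have : 0 ≤ Real.exp (ε * ∑ i, |(α i : ℝ)|) - 1 := sub_nonneg.2 (Real.one_le_exp
        (mul_nonneg hε.le (Finset.sum_nonneg fun i _ => abs_nonneg _)))
      positivity
    · exact mul_le_mul_of_nonneg_left (min_le_left _ _) (norm_nonneg _)
  rw [symbol, ← hsum.tsum_eq]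
  refine (tsum_of_norm_bounded (hbound.mul_right ‖u‖).hasSum fun α => ?_).trans ?_
  · rw [mul_smul, ← smul_sub, norm_smul, mul_assoc]
    exact mul_le_mul_of_nonneg_left (hterm α) (norm_nonneg _)
  · rw [tsum_mul_right]
    exact mul_le_mul_of_nonneg_right hεδ.le (norm_nonneg _)

/-- The spectrum of an operator with constant diagonals is the range of its symbol. -/
theorem spectrum_eq_range_symbol (hp : p ≠ ∞) (hc : Summable fun α => ‖c α‖) :
    spectrum ℂ (∑' α, c α • shift α : LatticeLp N p →L[ℂ] LatticeLp N p) = range (symbol c) := by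
  set B : LatticeLp N p →L[ℂ] LatticeLp N p := ∑' α, c α • shift α
  ext z
  constructor
  · contrapose!
    intro hz
    rw [spectrum.notMem_iff]
    let m : IntLattice N → LatticeLp N p →L[ℂ] LatticeLp N p :=
      fun α => algebraMap ℂ _ ((Pi.single 0 z : IntLattice N → ℂ) α - c α)
    refine isUnit_of_forall_torus (shiftHom N p) (fun g => norm_shift_le _)
      (S := range (algebraMap ℂ (LatticeLp N p →L[ℂ] LatticeLp N p)))
      ?_ ?_ (m := m) (fun α => ⟨_, rfl⟩) ?_ fun t => ?_
    · rintro _ ⟨x, rfl⟩ _ ⟨y, rfl⟩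
      exact Algebra.commutes x _
    · rintro _ ⟨x, rfl⟩ g
      exact Algebra.commutes x _
    · have h1 := hasSum_ite_eq (0 : IntLattice N)
        (algebraMap ℂ (LatticeLp N p →L[ℂ] LatticeLp N p) z)
      refine (h1.sub (hasSum_smul_shift hc)).congr_fun fun α => ?_
      simp only [m, map_sub, sub_mul, shiftHom_ofAdd]
      congr 1
      by_cases hα : α = 0
      · subst hα
        simp
      · simp [hα]
    · have hne : z - symbol c t ≠ 0 := fun h => hz ⟨t, (sub_eq_zero.1 h).symm⟩
      refine ⟨_, ⟨z - symbol c t, rfl⟩, _, ⟨(z - symbol c t)⁻¹, rfl⟩, ?_, ?_⟩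
      · have h1 := (hasSum_ite_eq (0 : IntLattice N) z).sub (summable_symbol hc t).hasSum
        have h2 := h1.map (algebraMap ℂ (LatticeLp N p →L[ℂ] LatticeLp N p))
          (continuous_algebraMap _ _)
        refine h2.congr_fun fun α => ?_
        change (∏ i, (t i : ℂ) ^ (-α i)) • algebraMap ℂ (LatticeLp N p →L[ℂ] LatticeLp N p) _ =
          algebraMap ℂ (LatticeLp N p →L[ℂ] LatticeLp N p) _
        rw [Algebra.algebraMap_eq_smul_one, Algebra.algebraMap_eq_smul_one, smul_smul]
        congr 1
        by_cases hα : α = 0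
        · subst hα
          simp
        · simp [hα, mul_comm]
      · rw [← map_mul, mul_inv_cancel₀ hne, map_one]
  · rintro ⟨t, rfl⟩
    rw [spectrum.mem_iff]
    rintro ⟨U, hU⟩
    let V : LatticeLp N p →L[ℂ] LatticeLp N p :=
      ((U⁻¹ : (LatticeLp N p →L[ℂ] LatticeLp N p)ˣ) : LatticeLp N p →L[ℂ] LatticeLp N p)
    obtain ⟨u, hu, hle⟩ := exists_norm_sub_symbol_smul_le hp hc t
      (δ := (2 * (‖V‖ + 1))⁻¹) (by positivity)
    have h1 : u = V ((U : LatticeLp N p →L[ℂ] LatticeLp N p) u) := by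
      rw [← mul_apply_eq_comp, show V * U = 1 from Units.inv_mul U, one_apply_eq_self]
    have h2 : ‖(U : LatticeLp N p →L[ℂ] LatticeLp N p) u‖ ≤ (2 * (‖V‖ + 1))⁻¹ * ‖u‖ := by
      have h : (U : LatticeLp N p →L[ℂ] LatticeLp N p) u = -(B u - symbol c t • u) := by
        rw [hU, Algebra.algebraMap_eq_smul_one]
        exact (neg_sub _ _).symm
      rw [h, norm_neg]
      exact hle
    have h3 : ‖u‖ ≤ ‖V‖ * ((2 * (‖V‖ + 1))⁻¹ * ‖u‖) := by
      conv_lhs => rw [h1]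
      exact V.le_of_opNorm_le_of_le le_rfl h2
    have hu0 : 0 < ‖u‖ := norm_pos_iff.2 hu
    have h4 : ‖V‖ * (2 * (‖V‖ + 1))⁻¹ < 1 := by
      rw [← div_eq_mul_inv, div_lt_one (by positivity)]
      linarith [norm_nonneg V]
    nlinarith

end LatticeOp

/-- Finite rank operators map weakly null sequences to null sequences. -/
theorem ContinuousLinearMap.tendsto_apply_zero_of_hasFiniteRange {E : Type*} [NormedAddCommGroup E]
    [NormedSpace ℂ E] {F : E →L[ℂ] E} (hF : F.toLinearMap.HasFiniteRange) {w : ℕ → E}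
    (hw : ∀ φ : StrongDual ℂ E, Tendsto (fun j => φ (w j)) atTop (𝓝 0)) :
    Tendsto (fun j => F (w j)) atTop (𝓝 0) := by
  have : FiniteDimensional ℂ F.range := Module.Finite.iff_fg.2 hF
  let e := (Module.finBasis ℂ F.range).equivFunL
  let F' : E →L[ℂ] F.range := F.codRestrict F.range fun x => ⟨x, rfl⟩
  have h : Tendsto (fun j => e (F' (w j))) atTop (𝓝 0) :=
    tendsto_pi_nhds.2 fun i => hw ((ContinuousLinearMap.proj i :
      (Fin (Module.finrank ℂ F.range) → ℂ) →L[ℂ] ℂ) ∘L e.toContinuousLinearMap ∘L F')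
  have h' := ((F.range.subtypeL ∘L e.symm.toContinuousLinearMap).continuous.tendsto _).comp h
  rw [map_zero] at h'
  exact h'.congr fun j => congrArg Subtype.val (e.symm_apply_apply (F' (w j)))

theorem continuous_mk_approximableIdeal (E : Type*) [NormedAddCommGroup E] [NormedSpace ℂ E] :
    Continuous (Ideal.Quotient.mk (approximableIdeal E)) :=
  AddMonoidHomClass.continuous_of_bound _ 1 fun T => by
    rw [one_mul]
    exact Submodule.Quotient.norm_mk_le (approximableIdeal E) T

/-- Wiener's lemma modulo approximable operators. -/
theorem isFredholm_of_forall_torus {E : Type*} [NormedAddCommGroup E] [NormedSpace ℂ E]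
    [CompleteSpace E] {N : ℕ} (v : Multiplicative (Fin N → ℤ) →* (E →L[ℂ] E))
    (hv : ∀ g, ‖v g‖ ≤ 1) {S : Set (E →L[ℂ] E)}
    (hS : ∀ x ∈ S, ∀ y ∈ S, x * y - y * x ∈ approximableIdeal E)
    (hSv : ∀ x ∈ S, ∀ g, x * v g - v g * x ∈ approximableIdeal E)
    {m : (Fin N → ℤ) → E →L[ℂ] E} (hm : ∀ α, m α ∈ S) {T : E →L[ℂ] E}
    (hT : HasSum (fun α => m α * v (.ofAdd α)) T)
    (h : ∀ t : Fin N → Circle, ∃ b ∈ S, ∃ c ∈ S,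
      HasSum (fun α : Fin N → ℤ => (∏ i, (t i : ℂ) ^ (-α i)) • m α) b ∧
        b * c - 1 ∈ approximableIdeal E) :
    T.IsFredholm := by
  let π : (E →L[ℂ] E) →+* ApproximableQuotient E := Ideal.Quotient.mk (approximableIdeal E)
  have hπ : Continuous π := continuous_mk_approximableIdeal E
  have hπeq {x y} (hxy : x - y ∈ approximableIdeal E) : π x = π y := Ideal.Quotient.eq.2 hxy
  refine isFredholm_of_isUnit_mk (isUnit_of_forall_torus (A := ApproximableQuotient E)
    ((π : (E →L[ℂ] E) →* ApproximableQuotient E).comp v) (fun g => ?_)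
    (S := π '' S) ?_ ?_ (m := fun α => π (m α)) (fun α => ⟨m α, hm α, rfl⟩) ?_ fun t => ?_)
  · exact (Submodule.Quotient.norm_mk_le (approximableIdeal E) (v g)).trans (hv g)
  · rintro _ ⟨x, hx, rfl⟩ _ ⟨y, hy, rfl⟩
    rw [← map_mul, ← map_mul, hπeq (hS x hx y hy)]
  · rintro _ ⟨x, hx, rfl⟩ g
    exact ((map_mul π _ _).symm.trans (hπeq (hSv x hx g))).trans (map_mul π _ _)
  · exact (hT.map π hπ).congr_fun fun α => (map_mul π _ _).symm
  · obtain ⟨b, hb, c, hc, hsum, hbc⟩ := h t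
    refine ⟨π b, ⟨b, hb, rfl⟩, π c, ⟨c, hc, rfl⟩, (hsum.map π hπ).congr_fun fun α => rfl, ?_⟩
    rw [← map_mul, hπeq hbc, map_one]

namespace LatticeOp

variable {N : ℕ} {p : ℝ≥0∞} [Fact (1 ≤ p)] {a : IntLattice N → LatticeLp N ∞}
  {c : IntLattice N → ℂ}

theorem symbol_ne_zero_of_isFredholm (hp : 1 < p) (hp' : p < ∞) (ha : Summable fun α => ‖a α‖)
    (hso : ∀ α, SlowlyOscillating (a α)) (hA : (wienerOp p a).IsFredholm) {g : ℕ → IntLattice N}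
    (hg : Tendsto g atTop cofinite) (hc : ∀ α, Tendsto (fun j => a α (g j)) atTop (𝓝 (c α)))
    (t : Fin N → Circle) : symbol c t ≠ 0 := by
  intro h0
  obtain ⟨hcs, hlim⟩ := isLimitOperator_of_tendsto hp hp' ha hso hg hc
  obtain ⟨R, hR, -⟩ := hA.exists_isQuasiInverse
  have hF : (R * wienerOp p a - 1).toLinearMap.HasFiniteRange :=
    (LinearMap.FiniteRangeSetoid.equiv_iff_hasFiniteRange.1 hR)
  obtain ⟨u, hu, hle⟩ := exists_norm_sub_symbol_smul_le hp'.ne hcs t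
    (δ := (2 * (‖R‖ + 1))⁻¹) (by positivity)
  rw [h0, zero_smul, sub_zero] at hle
  have h1 := ContinuousLinearMap.tendsto_apply_zero_of_hasFiniteRange hF
    fun φ => tendsto_dual_apply_shift hp hp' hg φ u
  have h2 := ((hlim.tendsto_apply u).norm.const_mul ‖R‖).add h1.norm
  rw [norm_zero, add_zero] at h2
  have h3 := ge_of_tendsto h2 (b := ‖u‖) <| .of_forall fun j => by
    have hw : shift (g j) u = R (wienerOp p a (shift (g j) u)) -
        (R * wienerOp p a - 1) (shift (g j) u) := (sub_sub_cancel _ _).symm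
    have hn : ‖conjShift (wienerOp p a) (g j) u‖ = ‖wienerOp p a (shift (g j) u)‖ :=
      norm_shift_apply _ _
    calc ‖u‖ = ‖shift (g j) u‖ := (norm_shift_apply _ _).symm
      _ ≤ _ := (congrArg norm hw).trans_le (norm_sub_le _ _)
      _ ≤ _ := by
        rw [hn]
        exact add_le_add_left (R.le_opNorm _) _
  have h4 := h3.trans (mul_le_mul_of_nonneg_left hle (norm_nonneg R))
  have hu0 : 0 < ‖u‖ := norm_pos_iff.2 hu
  have h5 : ‖R‖ * (2 * (‖R‖ + 1))⁻¹ < 1 := by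
    rw [← div_eq_mul_inv, div_lt_one (by positivity)]
    linarith [norm_nonneg R]
  nlinarith

theorem SlowlyOscillating.of_hasSum {m : IntLattice N → LatticeLp N ∞} {b : LatticeLp N ∞}
    (hm : Summable fun α => ‖m α‖) (hso : ∀ α, SlowlyOscillating (m α)) (hb : HasSum m b) :
    SlowlyOscillating b := by
  intro y
  have hev (x : IntLattice N) : HasSum (fun α => m α x) (b x) :=
    hb.mapL (lp.evalCLM ℂ (fun _ : IntLattice N => ℂ) ∞ x)
  have h := tendsto_tsum_of_dominated_convergence (𝓕 := cofinite)
    (f := fun x α => m α (x + y) - m α x) (hm.mul_left 2) (fun α => hso α y)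
    (.of_forall fun x α => (norm_sub_le _ _).trans (by
      have h1 := lp.norm_apply_le_norm (by simp) (m α) (x + y)
      have h2 := lp.norm_apply_le_norm (by simp) (m α) x
      linarith))
  rw [tsum_zero] at h
  exact h.congr fun x => ((hev (x + y)).sub (hev x)).tsum_eq

/-- A slowly oscillating function which is bounded away from zero at infinity is invertible modulo
functions vanishing at infinity, with slowly oscillating inverse. -/
theorem SlowlyOscillating.exists_inv {b : LatticeLp N ∞} (hb : SlowlyOscillating b) {ε : ℝ}
    (hε : 0 < ε) (h : ∀ᶠ x in cofinite, ε ≤ ‖b x‖) :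
    ∃ d : LatticeLp N ∞, SlowlyOscillating d ∧
      Tendsto (b * d - 1 : LatticeLp N ∞) cofinite (𝓝 0) := by
  classical
  let d : LatticeLp N ∞ := ofBounded (fun x => if ε ≤ ‖b x‖ then (b x)⁻¹ else 0) ε⁻¹ fun x => by
    split_ifs with hx
    · rw [norm_inv]
      exact inv_anti₀ hε hx
    · simpa using hε.le
  have hd {x} (hx : ε ≤ ‖b x‖) : d x = (b x)⁻¹ := if_pos hx
  refine ⟨d, fun y => ?_, ?_⟩
  · have hy : ∀ᶠ x in cofinite, ε ≤ ‖b (x + y)‖ :=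
      (add_left_injective y).tendsto_cofinite.eventually h
    have h0 := (hb y).norm.mul_const (ε⁻¹ * ε⁻¹)
    rw [norm_zero, zero_mul] at h0
    refine squeeze_zero_norm' ?_ h0
    filter_upwards [h, hy] with x hx hxy
    have hx0 : b x ≠ 0 := norm_pos_iff.1 (hε.trans_le hx)
    have hxy0 : b (x + y) ≠ 0 := norm_pos_iff.1 (hε.trans_le hxy)
    rw [hd hx, hd hxy, inv_sub_inv hxy0 hx0, norm_div, norm_mul, div_eq_mul_inv, mul_inv,
      norm_sub_rev]
    gcongr
  · refine tendsto_const_nhds.congr' ?_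
    filter_upwards [h] with x hx
    have hx0 : b x ≠ 0 := norm_pos_iff.1 (hε.trans_le hx)
    change 0 = b x * d x - 1
    rw [hd hx, mul_inv_cancel₀ hx0, sub_self]

/-- If all symbols of limit operators are nonzero at `t`, then the functions
`x ↦ ∑_α a_α(x) t^{-α}` are bounded away from zero at infinity. -/
theorem exists_eventually_le_norm (ha : Summable fun α => ‖a α‖) (t : Fin N → Circle)
    (h : ∀ (g : ℕ → IntLattice N) (c : IntLattice N → ℂ), Tendsto g atTop cofinite →
      (∀ α, Tendsto (fun j => a α (g j)) atTop (𝓝 (c α))) → symbol c t ≠ 0)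
    {b : IntLattice N → ℂ}
    (hb : ∀ x, HasSum (fun α => a α x * ∏ i, (t i : ℂ) ^ (-α i)) (b x)) :
    ∃ ε > 0, ∀ᶠ x in cofinite, ε ≤ ‖b x‖ := by
  by_contra! hcon
  have hne : (comap (fun x => ‖b x‖) (𝓝 0) ⊓ cofinite).NeBot := by
    rw [inf_neBot_iff_frequently_left]
    intro q hq
    obtain ⟨s, hs, hsq⟩ := mem_comap.1 hq
    obtain ⟨ε, hε, hεs⟩ := Metric.mem_nhds_iff.1 hs
    refine (hcon ε hε).mono fun x hx => hsq (hεs ?_)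
    simpa using hx
  have : (cofinite : Filter (IntLattice N)).IsCountablyGenerated :=
    HasCountableBasis.isCountablyGenerated ⟨hasBasis_cofinite, Countable.ofPred_finite⟩
  obtain ⟨g, hg⟩ := exists_seq_tendsto (comap (fun x => ‖b x‖) (𝓝 0) ⊓ cofinite)
  obtain ⟨hg2, hg1⟩ := tendsto_inf.1 hg
  rw [tendsto_comap_iff] at hg2
  obtain ⟨c, k, hk, hc⟩ := exists_subseq_tendsto_coeff a g
  refine h (g ∘ k) c (hg1.comp hk.tendsto_atTop) hc ?_
  have h1 : Tendsto (fun j => b (g (k j))) atTop (𝓝 0) :=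
    tendsto_zero_iff_norm_tendsto_zero.2 (hg2.comp hk.tendsto_atTop)
  refine tendsto_nhds_unique ?_ h1
  refine (tendsto_tsum_of_dominated_convergence ha
    (fun α => (hc α).mul_const (∏ i, (t i : ℂ) ^ (-α i))) (.of_forall fun j α => ?_)).congr
    fun j => (hb (g (k j))).tsum_eq
  rw [norm_mul, norm_prod_circle_zpow_neg, mul_one]
  exact lp.norm_apply_le_norm (by simp) _ _

theorem isFredholm_of_symbol_ne_zero (ha : Summable fun α => ‖a α‖)
    (hso : ∀ α, SlowlyOscillating (a α))
    (h : ∀ (g : ℕ → IntLattice N) (c : IntLattice N → ℂ), Tendsto g atTop cofinite →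
      (∀ α, Tendsto (fun j => a α (g j)) atTop (𝓝 (c α))) → ∀ t, symbol c t ≠ 0) :
    (wienerOp p a).IsFredholm := by
  refine isFredholm_of_forall_torus (shiftHom N p) (fun g => norm_shift_le g.toAdd)
    (S := {y | ∃ b : LatticeLp N ∞, SlowlyOscillating b ∧ mulOp b = y}) ?_ ?_
    (m := fun α => mulOp (a α)) (fun α => ⟨a α, hso α, rfl⟩) (hasSum_wienerOp ha) fun t => ?_
  · rintro _ ⟨b, -, rfl⟩ _ ⟨d, -, rfl⟩
    rw [← mulHom_apply, ← mulHom_apply, ← map_mul, ← map_mul, mul_comm, sub_self]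
    exact Ideal.zero_mem _
  · rintro _ ⟨b, hb, rfl⟩ g
    change mulOp b * shift g.toAdd - shift g.toAdd * mulOp b ∈ _
    rw [shift_mul_mulOp, ← sub_mul, ← mulHom_apply, ← mulHom_apply, ← map_sub, mulHom_apply]
    refine Ideal.mul_mem_right _ _ (mulOp_mem_approximableIdeal ?_)
    have h1 := (hb (-g.toAdd)).neg
    rw [neg_zero] at h1
    refine h1.congr fun x => ?_
    change _ = b x - b (x - g.toAdd)
    rw [neg_sub, sub_eq_add_neg x]
  · let m : IntLattice N → LatticeLp N ∞ := fun α => (∏ i, (t i : ℂ) ^ (-α i)) • a α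
    have hm : Summable fun α => ‖m α‖ := ha.congr fun α => by
      rw [norm_smul, norm_prod_circle_zpow_neg, one_mul]
    have hmso (α) : SlowlyOscillating (m α) := fun y => by
      have h1 := (hso α y).const_mul (∏ i, (t i : ℂ) ^ (-α i))
      rw [mul_zero] at h1
      refine h1.congr fun x => ?_
      rw [mul_sub]
      rfl
    have hb : HasSum m (∑' α, m α) := hm.of_norm.hasSum
    set b := ∑' α, m α
    have hbso : SlowlyOscillating b := .of_hasSum hm hmso hb
    obtain ⟨ε, hε, hbε⟩ := exists_eventually_le_norm ha t (fun g c hg hc => h g c hg hc t)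
      fun x => (hb.mapL (lp.evalCLM ℂ (fun _ : IntLattice N => ℂ) ∞ x)).congr_fun
        fun α => mul_comm _ _
    obtain ⟨d, hd, hbd⟩ := hbso.exists_inv hε hbε
    refine ⟨_, ⟨b, hbso, rfl⟩, _, ⟨d, hd, rfl⟩, ?_, ?_⟩
    · refine (hb.map (mulHom N p) (continuous_mulHom N p)).congr_fun fun α => ?_
      exact (map_smul (mulHom N p) (∏ i, (t i : ℂ) ^ (-α i)) (a α)).symm
    · convert mulOp_mem_approximableIdeal (p := p) hbd using 1
      rw [← mulHom_apply, ← mulHom_apply, ← mulHom_apply, map_sub, map_mul, map_one]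

theorem SlowlyOscillating.sub_const {f : IntLattice N → ℂ} (hf : SlowlyOscillating f) (z : ℂ) :
    SlowlyOscillating fun x => f x - z := by
  intro y
  simpa using hf y

/-- The essential spectrum consists of the values of the symbols of all limit operators. -/
theorem mem_essentialSpectrum_iff (hp : 1 < p) (hp' : p < ∞) (ha : Summable fun α => ‖a α‖)
    (hso : ∀ α, SlowlyOscillating (a α)) {z : ℂ} :
    z ∈ essentialSpectrum (wienerOp p a) ↔
      ∃ (g : ℕ → IntLattice N) (c : IntLattice N → ℂ), Tendsto g atTop cofinite ∧
        (∀ α, Tendsto (fun j => a α (g j)) atTop (𝓝 (c α))) ∧ ∃ t, symbol c t = z := by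
  classical
  let e : IntLattice N → ℂ := Pi.single 0 z
  let a' : IntLattice N → LatticeLp N ∞ := fun α => a α - algebraMap ℂ _ (e α)
  have hfin : ∀ α ∉ ({0} : Finset (IntLattice N)), e α = 0 := fun α hα => by
    simp [e, Finset.mem_singleton.not.1 hα]
  have hes : Summable fun α => ‖e α‖ :=
    summable_of_ne_finset_zero (s := {0}) fun α hα => by rw [hfin α hα, norm_zero]
  have ha' : Summable fun α => ‖a' α‖ :=
    Summable.of_nonneg_of_le (fun _ => norm_nonneg _) (fun α => (norm_sub_le _ _).trans_eq
      (by rw [norm_algebraMap'])) (ha.add hes)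
  have hval (α x) : a' α x = a α x - e α := by
    change a α x - algebraMap ℂ (LatticeLp N ∞) (e α) x = _
    rw [Algebra.algebraMap_eq_smul_one]
    simp
  have hso' (α) : SlowlyOscillating (a' α) := by
    have := (hso α).sub_const (e α)
    rwa [← funext (hval α)] at this
  have hop : wienerOp p a - z • ContinuousLinearMap.id ℂ (LatticeLp N p) = wienerOp p a' := by
    refine HasSum.unique (f := fun α => mulOp (a' α) ∘L shift α) ?_ (hasSum_wienerOp ha')
    have h1 : HasSum (fun α => e α • (shift α : LatticeLp N p →L[ℂ] LatticeLp N p))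
        (z • ContinuousLinearMap.id ℂ (LatticeLp N p)) := by
      convert hasSum_single (f := fun α => e α • (shift α : LatticeLp N p →L[ℂ] LatticeLp N p))
        0 (fun α hα => by simp [e, hα]) using 1
      simp [e]
      rfl
    refine ((hasSum_wienerOp ha).sub h1).congr_fun fun α => ?_
    ext u x
    change a' α x * u (x - α) = a α x * u (x - α) - e α * u (x - α)
    rw [hval]
    ring
  have hsymb {c : IntLattice N → ℂ} (hc : Summable fun α => ‖c α‖) (t : Fin N → Circle) :
      symbol (fun α => c α - e α) t = symbol c t - z := by
    have h1 := (summable_symbol hc t).hasSum.sub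
      (hasSum_single (f := fun α => e α * ∏ i, (t i : ℂ) ^ (-α i)) 0
        fun α hα => by simp [e, hα])
    simp only [← sub_mul] at h1
    refine h1.tsum_eq.trans ?_
    simp [e, symbol]
  change ¬ (wienerOp p a - z • ContinuousLinearMap.id ℂ (LatticeLp N p)).IsFredholm ↔ _
  rw [hop]
  constructor
  · contrapose!
    intro h
    refine isFredholm_of_symbol_ne_zero ha' hso' fun g c' hg hc' t h0 => ?_
    have hc (α) : Tendsto (fun j => a α (g j)) atTop (𝓝 (c' α + e α)) :=
      ((hc' α).add_const (e α)).congr fun j => by rw [hval, sub_add_cancel]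
    have hcs := (isLimitOperator_of_tendsto hp hp' ha hso hg hc).1
    refine h g _ hg hc t ?_
    have := hsymb hcs t
    simp only [add_sub_cancel_right] at this
    rw [h0] at this
    exact (sub_eq_zero.1 this.symm)
  · rintro ⟨g, c, hg, hc, t, rfl⟩ hF
    have hcs := (isLimitOperator_of_tendsto hp hp' ha hso hg hc).1
    refine symbol_ne_zero_of_isFredholm (c := fun α => c α - e α) hp hp' ha' hso' hF hg
      (fun α => ?_) t ?_
    · exact ((hc α).sub_const (e α)).congr fun j => (hval _ _).symm
    · rw [hsymb hcs, sub_self]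

end LatticeOp

end

theorem mainTheorem9 {N : ℕ} (hN : 0 < N)
    (a : IntLattice N → LatticeLp N ∞)
    (ha : Summable fun α => ‖a α‖)
    (hso : ∀ α, LatticeOp.SlowlyOscillating (a α))
    (p q : ℝ≥0∞) [Fact (1 ≤ p)] [Fact (1 ≤ q)]
    (hp : 1 < p) (hp' : p < ∞) (hq : 1 < q) (hq' : q < ∞) :
    (∀ (g : ℕ → IntLattice N) (B : LatticeLp N q →L[ℂ] LatticeLp N q),
      LatticeOp.IsLimitOperator (LatticeOp.wienerOp q a) g B →
        (∃! c : IntLattice N → ℂ, LatticeOp.HasConstantDiagonals B c) ∧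
        ∀ c : IntLattice N → ℂ, LatticeOp.HasConstantDiagonals B c →
          ∀ α x, Tendsto (fun j => a α (x + g j)) atTop (𝓝 (c α))) ∧
    LatticeOp.essentialSpectrum (LatticeOp.wienerOp p a) =
      ⋃ B ∈ LatticeOp.operatorSpectrum (LatticeOp.wienerOp q a), spectrum ℂ B ∧
    LatticeOp.essentialSpectrum (LatticeOp.wienerOp p a) =
      ⋃ B ∈ LatticeOp.operatorSpectrum (LatticeOp.wienerOp q a),
        ⋃ c ∈ {c : IntLattice N → ℂ | LatticeOp.HasConstantDiagonals B c},
          ⋃ t : Fin N → Circle, {LatticeOp.symbol c t} := by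
  have hcoeff (g : ℕ → IntLattice N) (B : LatticeLp N q →L[ℂ] LatticeLp N q)
      (hB : LatticeOp.IsLimitOperator (LatticeOp.wienerOp q a) g B) (c : IntLattice N → ℂ)
      (hc : LatticeOp.HasConstantDiagonals B c) (α x : IntLattice N) :
      Tendsto (fun j => a α (x + g j)) atTop (𝓝 (c α)) := by
    rw [hc.coeff_eq]
    exact hB.tendsto_const ha hso α x
  have hsymbol : LatticeOp.essentialSpectrum (LatticeOp.wienerOp p a) =
      ⋃ B ∈ LatticeOp.operatorSpectrum (LatticeOp.wienerOp q a),
        ⋃ c ∈ {c : IntLattice N → ℂ | LatticeOp.HasConstantDiagonals B c},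
          ⋃ t : Fin N → Circle, {LatticeOp.symbol c t} := by
    ext z
    rw [LatticeOp.mem_essentialSpectrum_iff hp hp' ha hso]
    simp only [mem_iUnion, mem_singleton_iff, mem_ofPred_eq, exists_prop]
    constructor
    · rintro ⟨g, c, hg, hc, t, rfl⟩
      obtain ⟨hcs, hB⟩ := LatticeOp.isLimitOperator_of_tendsto hq hq' ha hso hg hc
      exact ⟨_, ⟨g, hB⟩, c, ⟨hcs, rfl⟩, t, rfl⟩
    · rintro ⟨B, ⟨g, hB⟩, c, hc, t, rfl⟩
      exact ⟨g, c, hB.tendsto_infinity, fun α => by simpa using hcoeff g B hB c hc α 0, t, rfl⟩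
  refine ⟨fun g B hB => ⟨⟨_, hB.hasConstantDiagonals hq'.ne ha hso, fun c hc =>
    funext hc.coeff_eq⟩, hcoeff g B hB⟩, ?_, hsymbol⟩
  rw [hsymbol]
  refine iUnion₂_congr fun B ⟨g, hB⟩ => ?_
  have hc := hB.hasConstantDiagonals hq'.ne ha hso
  have hset : {c : IntLattice N → ℂ | LatticeOp.HasConstantDiagonals B c} =
      {fun α => B (lp.single q 0 1) α} := by
    ext c
    exact ⟨fun h => funext h.coeff_eq, fun h => by rw [mem_singleton_iff.1 h]; exact hc⟩
  have hspec := LatticeOp.spectrum_eq_range_symbol (p := q) hq'.ne hc.1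
  rw [← hc.2] at hspec
  rw [hset, biUnion_singleton, hspec, iUnion_singleton_eq_range]
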